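/- **Setting.** Let $H^2(\mathbb D)$, $H^2(\mathbb D^2)$ and, for a complex Hilbert space $E$, $H^2(\mathbb D;E)$ be the Hardy spaces of functions with square-summable Taylor coefficients, normed by the $\ell^2$ norm of the coefficients. An *inner function* $\Phi\in H^\infty(\mathbb D;\mathcal B(E,F))$ is a bounded analytic $\mathcal B(E,F)$-valued function on $\mathbb D$ such that $f\mapsto \Phi f$ is an isometry $H^2(\mathbb D;E)\to H^2(\mathbb D;F)$; scalar inner functions are the case $E=F=\mathbb C$. For a scalar inner function $\varphi$ put $K_\varphi=H^2(\mathbb D)\ominus\varphi H^2(\mathbb D)$. For a function $h$ of one variable write $h_{z_2}(z_1,z_2)=h(z_2)$, and let $h_{z_2}H^2_{z_1}(\mathbb D)$ be the space of functions $h(z_2)f(z_1)$ with $f\in H^2(\mathbb D)$. Identify $H^2(\mathbb D^2)$ with $H^2(\mathbb D;H^2(\mathbb D))$ through the variable $z_1$; so for $\Psi\in H^\infty(\mathbb D;\mathcal B(E,K_\varphi))$ and $f\in H^2(\mathbb D;E)$, $\Psi f$ is the function $(z_1,z_2)\mapsto(\Psi(z_1)f(z_1))(z_2)$. For $\sigma>0$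 and $\theta\in[0,2\pi)$ the *3-Brownian shift* $T_{\sigma,\theta}$ on $H^2(\mathbb D^2)\oplus H^2(\mathbb D)\oplus\mathbb C$ is $$T_{\sigma,\theta}(F,f,\alpha)=\bigl(z_1F+\sigma f_{z_2},\ zf+\sigma\alpha,\ e^{i\theta}\alpha\bigr).$$ Let $\mathcal M=\mathcal M_0\oplus\mathcal M_1$ with $\mathcal M_0\subseteq H^2(\mathbb D^2)$ and $\mathcal M_1\subseteq H^2(\mathbb D)\oplus\mathbb C$, and let $\mathcal E_{\mathcal M}$ be a Hilbert space. In the following, all sums $\oplus$ are orthogonal. * $\mathcal M$ is of *lifted Type I* (with multiplicity space $\mathcal E_{\mathcal M}$) if there are a scalar inner function $\varphi$ and an inner function $\Psi\in H^\infty(\mathbb D;\mathcal B(\mathcal E_{\mathcal M},K_\varphi))$ with $$\mathcal M_1=\varphi H^2(\mathbb D)\oplus\{0\},\qquad \mathcal M_0=\varphi_{z_2}H^2(\mathbb D^2)\oplus\Psi H^2(\mathbb D;\mathcal E_{\mathcal M}).$$ * $\mathcal M$ is of *lifted Type II* for $T_{\sigma,\theta}$ (with multiplicity space $\mathcal E_{\mathcal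 M}$ and function $g$) if there are a scalar inner function $\varphi$ whose radial limit $\varphi(e^{i\theta})$ exists and for which $$g(z)=\sigma\,\frac{\overline{\varphi(e^{i\theta})}\,\varphi(z)-1}{z-e^{i\theta}}$$ belongs to $H^2(\mathbb D)$, and an inner function $\Psi\in H^\infty(\mathbb D;\mathcal B(\mathcal E_{\mathcal M},K_\varphi))$ with $\Psi(0)\mathcal E_{\mathcal M}\perp g$, such that $$\mathcal M_1=\mathbb C\begin{bmatrix}g\\1\end{bmatrix}\oplus\bigl(\varphi H^2(\mathbb D)\oplus\{0\}\bigr),\qquad \mathcal M_0=\varphi_{z_2}H^2(\mathbb D^2)\oplus g_{z_2}H^2_{z_1}(\mathbb D)\oplus\Psi H^2(\mathbb D;\mathcal E_{\mathcal M}).$$ **Theorem.** Let $\theta_1,\theta_2\in[0,2\pi)$ and $\sigma_1,\sigma_2>0$. Let $\mathcal M$ and $\mathcal N$ be nonzero closed invariant subspaces of $T_{\sigma_1,\theta_1}$ and $T_{\sigma_2,\theta_2}$, respectively, each of lifted Type I or lifted Type II, with multiplicity spaces $\mathcal E_{\mathcal M}$ and $\mathcal E_{\mathcal N}$. Then there is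 a unitary $U:\mathcal M\to\mathcal N$ with $U\,T_{\sigma_1,\theta_1}|_{\mathcal M}=T_{\sigma_2,\theta_2}|_{\mathcal N}\,U$ if and only if $\sigma_1=\sigma_2$, $\dim\mathcal E_{\mathcal M}=\dim\mathcal E_{\mathcal N}$ (Hilbert space dimension), and one of the following holds: 1. both $\mathcal M$ and $\mathcal N$ are of lifted Type I; 2. both $\mathcal M$ and $\mathcal N$ are of lifted Type II, with functions $g^{(1)}$ and $g^{(2)}$ respectively, and $\theta_1=\theta_2$ and $\|g^{(1)}\|=\|g^{(2)}\|$. -/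

import Mathlib

open scoped ComplexConjugate Topology InnerProductSpace Complex.UnitDisc

universe u v

noncomputable section

/-! ### Square-summable families: helper facts -/

theorem lpTwo_summable_sq {ι : Type*} {E : Type*} [NormedAddCommGroup E]
    (a : lp (fun _ : ι => E) 2) : Summable fun i => ‖a i‖ ^ 2 := by
  simpa using (lp.memℓp a).summable (by simp)

theorem lpTwo_summable_smul {ι : Type*} {E : Type*} [NormedAddCommGroup E] [NormedSpace ℂ E]
    [CompleteSpace E] {c : ι → ℂ} (hc : Summable fun i => ‖c i‖ ^ 2)
    (a : lp (fun _ : ι => E) 2) : Summable fun i => c i • a i := by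
  refine Summable.of_norm_bounded (hc.add (lpTwo_summable_sq a)) fun i => ?_
  rw [norm_smul]
  nlinarith [sq_nonneg (‖c i‖ - ‖a i‖), sq_nonneg (‖c i‖), sq_nonneg (‖a i‖)]

theorem unitDisc_summable_sq (z : 𝔻) : Summable fun n : ℕ => ‖(z : ℂ) ^ n‖ ^ 2 := by
  have h : (fun n : ℕ => ‖(z : ℂ) ^ n‖ ^ 2) = fun n : ℕ => (‖(z : ℂ)‖ ^ 2) ^ n := by
    funext n
    rw [norm_pow, ← pow_mul, ← pow_mul, mul_comm]
  rw [h]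
  exact summable_geometric_of_lt_one (by positivity) z.sq_norm_lt_one

theorem unitBidisc_summable_sq (p : 𝔻 × 𝔻) :
    Summable fun k : ℕ × ℕ => ‖(p.1 : ℂ) ^ k.1 * (p.2 : ℂ) ^ k.2‖ ^ 2 := by
  have h := (unitDisc_summable_sq p.1).mul_of_nonneg (unitDisc_summable_sq p.2)
    (fun _ => by positivity) (fun _ => by positivity)
  refine h.congr fun k => ?_
  rw [norm_mul, mul_pow]

theorem unitDisc_coeff_eq_zero {E : Type*} [NormedAddCommGroup E] [NormedSpace ℂ E]
    {a : ℕ → E} (h : ∀ z : 𝔻, HasSum (fun n => (z : ℂ) ^ n • a n) 0) (n : ℕ) : a n = 0 := by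
  let p : FormalMultilinearSeries ℂ ℂ E := fun n => ContinuousMultilinearMap.mkPiRing ℂ (Fin n) (a n)
  have hcoeff : ∀ n, p.coeff n = a n := by
    intro n
    simp [p, FormalMultilinearSeries.coeff]
  have hp : HasFPowerSeriesAt (fun _ : ℂ => (0 : E)) p 0 := by
    rw [hasFPowerSeriesAt_iff]
    filter_upwards [Metric.ball_mem_nhds (0 : ℂ) one_pos] with z hz
    have hz' := h (Complex.UnitDisc.mk z (by simpa using hz))
    rw [Complex.UnitDisc.coe_mk] at hz'
    simpa only [hcoeff] using hz'
  rw [← hcoeff, hp.eq_zero]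
  simp [FormalMultilinearSeries.coeff]

/-- A square-summable family can be pushed forward along an injection without changing its norm. -/
theorem lpTwo_exists_extend {ι κ : Type*} {E : Type*} [NormedAddCommGroup E] {e : ι → κ}
    (he : Function.Injective e) (a : lp (fun _ : ι => E) 2) :
    ∃ b : lp (fun _ : κ => E) 2,
      (∀ i, b (e i) = a i) ∧ (∀ k, k ∉ Set.range e → b k = 0) ∧ ‖b‖ = ‖a‖ := by
  have h0 : ∀ k, k ∉ Set.range e → Function.extend e (a : ι → E) 0 k = 0 := fun k hk => by
    rw [Function.extend_apply' _ _ _ (by simpa using hk)]; rfl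
  have hs : ∀ k, k ∉ Set.range e → ‖Function.extend e (a : ι → E) 0 k‖ ^ (2 : ENNReal).toReal = 0 :=
    fun k hk => by rw [h0 k hk]; simp
  have hc : (fun k => ‖Function.extend e (a : ι → E) 0 k‖ ^ (2 : ENNReal).toReal) ∘ e =
      fun i => ‖a i‖ ^ (2 : ENNReal).toReal := by
    funext i; simp [he.extend_apply]
  have hmem : Memℓp (Function.extend e (a : ι → E) 0) 2 := by
    rw [memℓp_gen_iff (by simp), ← he.summable_iff hs, hc]
    exact (lp.memℓp a).summable (by simp)
  refine ⟨⟨_, hmem⟩, fun i => he.extend_apply _ _ _, h0, ?_⟩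
  rw [lp.norm_eq_tsum_rpow (by simp), lp.norm_eq_tsum_rpow (by simp)]
  congr 1
  rw [← he.tsum_eq (f := fun k => ‖Function.extend e (a : ι → E) 0 k‖ ^ (2 : ENNReal).toReal)
    (Function.support_subset_iff'.2 hs)]
  exact congrArg tsum hc

/-! ### The Hardy space `H²(𝔻; E)` -/

section HardyDisc

variable (E : Type u) [NormedAddCommGroup E] [InnerProductSpace ℂ E] [CompleteSpace E]

/-- The function `z ↦ ∑ aₙ zⁿ` on the disc with a given square-summable coefficient sequence. -/
def hardyDiscSeries : lp (fun _ : ℕ => E) 2 →ₗ[ℂ] (𝔻 → E) where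
  toFun a z := ∑' n : ℕ, (z : ℂ) ^ n • a n
  map_add' a b := by
    funext z
    simp only [lp.coeFn_add, Pi.add_apply, smul_add]
    exact (lpTwo_summable_smul (unitDisc_summable_sq z) a).tsum_add
      (lpTwo_summable_smul (unitDisc_summable_sq z) b)
  map_smul' c a := by
    funext z
    simp only [lp.coeFn_smul, Pi.smul_apply, RingHom.id_apply, smul_comm _ c]
    exact (lpTwo_summable_smul (unitDisc_summable_sq z) a).tsum_const_smul c

theorem hardyDiscSeries_injective : Function.Injective (hardyDiscSeries E) := by
  rw [injective_iff_map_eq_zero]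
  intro a ha
  ext n
  refine unitDisc_coeff_eq_zero (fun z => ?_) n
  have h := (lpTwo_summable_smul (unitDisc_summable_sq z) a).hasSum
  have h2 : ∑' n : ℕ, (z : ℂ) ^ n • a n = 0 := congrFun ha z
  rwa [h2] at h

/-- `H²(𝔻; E)`: the functions `f(z) = ∑ aₙ zⁿ` on the disc with `∑ ‖aₙ‖² < ∞`. -/
def HardyDisc : Type u := LinearMap.range (hardyDiscSeries E)

namespace HardyDisc

instance : AddCommGroup (HardyDisc E) :=
  inferInstanceAs (AddCommGroup (LinearMap.range (hardyDiscSeries E)))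

instance : Module ℂ (HardyDisc E) :=
  inferInstanceAs (Module ℂ (LinearMap.range (hardyDiscSeries E)))

instance : CoeFun (HardyDisc E) (fun _ => 𝔻 → E) := ⟨fun f => f.1⟩

/-- The linear bijection that sends a function to its sequence of Taylor coefficients. -/
def coeffEquiv : HardyDisc E ≃ₗ[ℂ] lp (fun _ : ℕ => E) 2 :=
  (LinearEquiv.ofInjective (hardyDiscSeries E) (hardyDiscSeries_injective E)).symm

/-- The norm is the `ℓ²` norm of the Taylor coefficients. -/
instance : NormedAddCommGroup (HardyDisc E) :=
  NormedAddCommGroup.induced _ _ (coeffEquiv E) (coeffEquiv E).injective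

instance : InnerProductSpace ℂ (HardyDisc E) := InnerProductSpace.induced (coeffEquiv E)

/-- Taylor coefficients as a unitary map. -/
def coeff : HardyDisc E ≃ₗᵢ[ℂ] lp (fun _ : ℕ => E) 2 where
  toLinearEquiv := coeffEquiv E
  norm_map' _ := rfl

instance : CompleteSpace (HardyDisc E) :=
  (completeSpace_congr (e := (coeff E).toEquiv) (coeff E).isometry.isUniformEmbedding).2 inferInstance

end HardyDisc

end HardyDisc

namespace HardyDisc

variable {E : Type u} [NormedAddCommGroup E] [InnerProductSpace ℂ E] [CompleteSpace E]

@[ext] theorem ext {f g : HardyDisc E} (h : ∀ z, f z = g z) : f = g := Subtype.ext (funext h)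

@[simp] theorem add_apply (f g : HardyDisc E) (z : 𝔻) : (f + g) z = f z + g z := rfl

@[simp] theorem smul_apply (c : ℂ) (f : HardyDisc E) (z : 𝔻) : (c • f) z = c • f z := rfl

@[simp] theorem zero_apply (z : 𝔻) : (0 : HardyDisc E) z = 0 := rfl

theorem hasSum_coeff (f : HardyDisc E) (z : 𝔻) :
    HasSum (fun n : ℕ => (z : ℂ) ^ n • coeff E f n) (f z) := by
  have h := (lpTwo_summable_smul (unitDisc_summable_sq z) (coeff E f)).hasSum
  have h2 : hardyDiscSeries E (coeff E f) = f.1 :=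
    congrArg Subtype.val ((LinearEquiv.ofInjective (hardyDiscSeries E)
      (hardyDiscSeries_injective E)).apply_symm_apply f)
  have h3 : ∑' n : ℕ, (z : ℂ) ^ n • coeff E f n = f z := congrFun h2 z
  rwa [h3] at h

/-- A function which is the sum of a power series with square-summable coefficients, as an element
of the Hardy space, together with its norm. -/
theorem exists_of_hasSum {F : 𝔻 → E} (a : lp (fun _ : ℕ => E) 2)
    (h : ∀ z : 𝔻, HasSum (fun n : ℕ => (z : ℂ) ^ n • a n) (F z)) :
    ∃ f : HardyDisc E, f.1 = F ∧ ‖f‖ = ‖a‖ :=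
  ⟨(coeff E).symm a, funext fun z => (h z).tsum_eq, (coeff E).symm.norm_map a⟩

end HardyDisc

/-! ### The Hardy space `H²(𝔻²)` -/

/-- The function `(z₁, z₂) ↦ ∑ aₘₙ z₁ᵐ z₂ⁿ` on the bidisc with a given square-summable family of
coefficients. -/
def hardyBidiscSeries : lp (fun _ : ℕ × ℕ => ℂ) 2 →ₗ[ℂ] (𝔻 × 𝔻 → ℂ) where
  toFun a p := ∑' k : ℕ × ℕ, ((p.1 : ℂ) ^ k.1 * (p.2 : ℂ) ^ k.2) • a k
  map_add' a b := by
    funext p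
    simp only [lp.coeFn_add, Pi.add_apply, smul_add]
    exact (lpTwo_summable_smul (unitBidisc_summable_sq p) a).tsum_add
      (lpTwo_summable_smul (unitBidisc_summable_sq p) b)
  map_smul' c a := by
    funext p
    simp only [lp.coeFn_smul, Pi.smul_apply, RingHom.id_apply, smul_comm _ c]
    exact (lpTwo_summable_smul (unitBidisc_summable_sq p) a).tsum_const_smul c

theorem hardyBidiscSeries_injective : Function.Injective hardyBidiscSeries := by
  rw [injective_iff_map_eq_zero]
  intro a ha
  have hs : ∀ z w : 𝔻, HasSum (fun k : ℕ × ℕ => ((z : ℂ) ^ k.1 * (w : ℂ) ^ k.2) • a k) 0 := by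
    intro z w
    have h := (lpTwo_summable_smul (unitBidisc_summable_sq (z, w)) a).hasSum
    have h2 : ∑' k : ℕ × ℕ, ((z : ℂ) ^ k.1 * (w : ℂ) ^ k.2) • a k = 0 := congrFun ha (z, w)
    rwa [h2] at h
  have hrow : ∀ (w : 𝔻) (m : ℕ), Summable fun n : ℕ => (w : ℂ) ^ n • a (m, n) := by
    intro w m
    refine Summable.of_norm_bounded ((unitDisc_summable_sq w).add
      ((lpTwo_summable_sq a).comp_injective (i := fun n : ℕ => (m, n))
        fun _ _ h => (Prod.ext_iff.1 h).2)) fun n => ?_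
    rw [norm_smul, Function.comp_apply]
    nlinarith [sq_nonneg (‖(w : ℂ) ^ n‖ - ‖a (m, n)‖), sq_nonneg (‖(w : ℂ) ^ n‖),
      sq_nonneg (‖a (m, n)‖)]
  have h1 : ∀ (w : 𝔻) (m : ℕ), ∑' n : ℕ, (w : ℂ) ^ n • a (m, n) = 0 := by
    intro w
    refine unitDisc_coeff_eq_zero fun z => ?_
    refine (hs z w).prod_fiberwise fun m => ?_
    have := (hrow w m).hasSum.const_smul ((z : ℂ) ^ m)
    simpa only [smul_smul] using this
  ext ⟨m, n⟩
  refine unitDisc_coeff_eq_zero (a := fun n => a (m, n)) (fun w => ?_) n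
  have h := (hrow w m).hasSum
  rwa [h1] at h

/-- `H²(𝔻²)`: the functions `F(z₁, z₂) = ∑ aₘₙ z₁ᵐ z₂ⁿ` on the bidisc with `∑ |aₘₙ|² < ∞`. -/
def HardyBidisc : Type := LinearMap.range hardyBidiscSeries

namespace HardyBidisc

instance : AddCommGroup HardyBidisc :=
  inferInstanceAs (AddCommGroup (LinearMap.range hardyBidiscSeries))

instance : Module ℂ HardyBidisc :=
  inferInstanceAs (Module ℂ (LinearMap.range hardyBidiscSeries))

instance : CoeFun HardyBidisc (fun _ => 𝔻 × 𝔻 → ℂ) := ⟨fun f => f.1⟩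

/-- The linear bijection that sends a function to its family of Taylor coefficients. -/
def coeffEquiv : HardyBidisc ≃ₗ[ℂ] lp (fun _ : ℕ × ℕ => ℂ) 2 :=
  (LinearEquiv.ofInjective hardyBidiscSeries hardyBidiscSeries_injective).symm

/-- The norm is the `ℓ²` norm of the Taylor coefficients. -/
instance : NormedAddCommGroup HardyBidisc :=
  NormedAddCommGroup.induced _ _ coeffEquiv coeffEquiv.injective

instance : InnerProductSpace ℂ HardyBidisc := InnerProductSpace.induced coeffEquiv

/-- Taylor coefficients as a unitary map. -/
def coeff : HardyBidisc ≃ₗᵢ[ℂ] lp (fun _ : ℕ × ℕ => ℂ) 2 where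
  toLinearEquiv := coeffEquiv
  norm_map' _ := rfl

instance : CompleteSpace HardyBidisc :=
  (completeSpace_congr (e := coeff.toEquiv) coeff.isometry.isUniformEmbedding).2 inferInstance

@[ext] theorem ext {f g : HardyBidisc} (h : ∀ p, f p = g p) : f = g := Subtype.ext (funext h)

@[simp] theorem add_apply (f g : HardyBidisc) (p : 𝔻 × 𝔻) : (f + g) p = f p + g p := rfl

@[simp] theorem smul_apply (c : ℂ) (f : HardyBidisc) (p : 𝔻 × 𝔻) : (c • f) p = c • f p := rfl

@[simp] theorem zero_apply (p : 𝔻 × 𝔻) : (0 : HardyBidisc) p = 0 := rfl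

theorem hasSum_coeff (f : HardyBidisc) (p : 𝔻 × 𝔻) :
    HasSum (fun k : ℕ × ℕ => ((p.1 : ℂ) ^ k.1 * (p.2 : ℂ) ^ k.2) • coeff f k) (f p) := by
  have h := (lpTwo_summable_smul (unitBidisc_summable_sq p) (coeff f)).hasSum
  have h2 : hardyBidiscSeries (coeff f) = f.1 :=
    congrArg Subtype.val ((LinearEquiv.ofInjective hardyBidiscSeries
      hardyBidiscSeries_injective).apply_symm_apply f)
  have h3 : ∑' k : ℕ × ℕ, ((p.1 : ℂ) ^ k.1 * (p.2 : ℂ) ^ k.2) • coeff f k = f p := congrFun h2 p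
  rwa [h3] at h

theorem exists_of_hasSum {F : 𝔻 × 𝔻 → ℂ} (a : lp (fun _ : ℕ × ℕ => ℂ) 2)
    (h : ∀ p : 𝔻 × 𝔻, HasSum (fun k : ℕ × ℕ => ((p.1 : ℂ) ^ k.1 * (p.2 : ℂ) ^ k.2) • a k) (F p)) :
    ∃ f : HardyBidisc, f.1 = F ∧ ‖f‖ = ‖a‖ :=
  ⟨coeff.symm a, funext fun p => (h p).tsum_eq, coeff.symm.norm_map a⟩

end HardyBidisc

/-! ### The 3-Brownian shift -/

theorem exists_hardyShift (f : HardyDisc ℂ) :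
    ∃ h : HardyDisc ℂ, h.1 = (fun z : 𝔻 => (z : ℂ) * f z) ∧ ‖h‖ = ‖f‖ := by
  obtain ⟨b, hb, hb0, hn⟩ := lpTwo_exists_extend Nat.succ_injective (HardyDisc.coeff ℂ f)
  obtain ⟨h, hh, hhn⟩ := HardyDisc.exists_of_hasSum (F := fun z : 𝔻 => (z : ℂ) * f z) b fun z => by
    rw [← Function.Injective.hasSum_iff Nat.succ_injective fun k hk => by rw [hb0 k hk, smul_zero]]
    refine ((f.hasSum_coeff z).mul_left (z : ℂ)).congr_fun ?_
    intro n
    simp only [Function.comp_apply, hb, smul_eq_mul, Nat.succ_eq_add_one]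
    ring
  exact ⟨h, hh, by rw [hhn, hn, LinearIsometryEquiv.norm_map]⟩

/-- The unilateral shift `S` on `H²(𝔻)`: `(S f)(z) = z f(z)`. -/
def hardyShift : HardyDisc ℂ →ₗᵢ[ℂ] HardyDisc ℂ where
  toFun f := ⟨fun z => (z : ℂ) * f z, by
    obtain ⟨h, hh, -⟩ := exists_hardyShift f
    exact hh ▸ h.2⟩
  map_add' f g := HardyDisc.ext fun z => mul_add (z : ℂ) (f z) (g z)
  map_smul' c f := HardyDisc.ext fun z => mul_left_comm (z : ℂ) c (f z)
  norm_map' f := by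
    obtain ⟨h, hh, hn⟩ := exists_hardyShift f
    rw [← hn]
    exact congrArg norm (Subtype.ext hh.symm)

theorem exists_hardyConst (c : ℂ) :
    ∃ h : HardyDisc ℂ, h.1 = (fun _ : 𝔻 => c) ∧ ‖h‖ = ‖c‖ := by
  obtain ⟨h, hh, hhn⟩ := HardyDisc.exists_of_hasSum (F := fun _ : 𝔻 => c)
    (lp.single 2 (0 : ℕ) c) fun z => by
      have h := hasSum_single (f := fun n : ℕ => (z : ℂ) ^ n •
        (lp.single 2 (0 : ℕ) c : lp (fun _ : ℕ => ℂ) 2) n) 0 fun n hn => by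
          rw [lp.single_apply_ne _ _ _ hn, smul_zero]
      rwa [pow_zero, one_smul, lp.single_apply_self] at h
  exact ⟨h, hh, by rw [hhn, lp.norm_single (by simp)]⟩

/-- The operator `1 ⊗ 1 : ℂ → H²(𝔻)` that sends a scalar to the constant function. -/
def hardyConst : ℂ →ₗᵢ[ℂ] HardyDisc ℂ where
  toFun c := ⟨fun _ => c, by
    obtain ⟨h, hh, -⟩ := exists_hardyConst c
    exact hh ▸ h.2⟩
  map_add' _ _ := rfl
  map_smul' _ _ := rfl
  norm_map' c := by
    obtain ⟨h, hh, hn⟩ := exists_hardyConst c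
    rw [← hn]
    exact congrArg norm (Subtype.ext hh.symm)

theorem exists_bidiscShift (F : HardyBidisc) :
    ∃ h : HardyBidisc, h.1 = (fun p : 𝔻 × 𝔻 => (p.1 : ℂ) * F p) ∧ ‖h‖ = ‖F‖ := by
  have he : Function.Injective fun k : ℕ × ℕ => (k.1 + 1, k.2) := by
    rintro ⟨a, b⟩ ⟨c, d⟩ h
    simpa using h
  obtain ⟨b, hb, hb0, hn⟩ := lpTwo_exists_extend he (HardyBidisc.coeff F)
  obtain ⟨h, hh, hhn⟩ := HardyBidisc.exists_of_hasSum
    (F := fun p : 𝔻 × 𝔻 => (p.1 : ℂ) * F p) b fun p => by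
    rw [← Function.Injective.hasSum_iff he fun k hk => by rw [hb0 k hk, smul_zero]]
    refine ((F.hasSum_coeff p).mul_left (p.1 : ℂ)).congr_fun ?_
    intro k
    simp only [Function.comp_apply, hb, smul_eq_mul]
    ring
  exact ⟨h, hh, by rw [hhn, hn, LinearIsometryEquiv.norm_map]⟩

/-- The operator `M_{z₁}` on `H²(𝔻²)`: `(M_{z₁} F)(z₁, z₂) = z₁ F(z₁, z₂)`. -/
def bidiscShift : HardyBidisc →ₗᵢ[ℂ] HardyBidisc where
  toFun F := ⟨fun p => (p.1 : ℂ) * F p, by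
    obtain ⟨h, hh, -⟩ := exists_bidiscShift F
    exact hh ▸ h.2⟩
  map_add' f g := HardyBidisc.ext fun p => mul_add (p.1 : ℂ) (f p) (g p)
  map_smul' c f := HardyBidisc.ext fun p => mul_left_comm (p.1 : ℂ) c (f p)
  norm_map' f := by
    obtain ⟨h, hh, hn⟩ := exists_bidiscShift f
    rw [← hn]
    exact congrArg norm (Subtype.ext hh.symm)

theorem exists_bidiscEmbed (f : HardyDisc ℂ) :
    ∃ h : HardyBidisc, h.1 = (fun p : 𝔻 × 𝔻 => f p.2) ∧ ‖h‖ = ‖f‖ := by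
  have he : Function.Injective fun n : ℕ => ((0 : ℕ), n) := fun a b h => by simpa using h
  obtain ⟨b, hb, hb0, hn⟩ := lpTwo_exists_extend he (HardyDisc.coeff ℂ f)
  obtain ⟨h, hh, hhn⟩ := HardyBidisc.exists_of_hasSum (F := fun p : 𝔻 × 𝔻 => f p.2) b fun p => by
    rw [← Function.Injective.hasSum_iff he fun k hk => by rw [hb0 k hk, smul_zero]]
    refine (f.hasSum_coeff p.2).congr_fun ?_
    intro n
    simp only [Function.comp_apply, hb, smul_eq_mul, pow_zero, one_mul]
  exact ⟨h, hh, by rw [hhn, hn, LinearIsometryEquiv.norm_map]⟩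

/-- The isometric embedding `J : H²(𝔻) → H²(𝔻²)`: `(J f)(z₁, z₂) = f(z₂)`. -/
def bidiscEmbed : HardyDisc ℂ →ₗᵢ[ℂ] HardyBidisc where
  toFun f := ⟨fun p => f p.2, by
    obtain ⟨h, hh, -⟩ := exists_bidiscEmbed f
    exact hh ▸ h.2⟩
  map_add' _ _ := rfl
  map_smul' _ _ := rfl
  norm_map' f := by
    obtain ⟨h, hh, hn⟩ := exists_bidiscEmbed f
    rw [← hn]
    exact congrArg norm (Subtype.ext hh.symm)

/-- The Hilbert space `H²(𝔻) ⊕ ℂ`. -/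
abbrev LowerSpace : Type := WithLp 2 (HardyDisc ℂ × ℂ)

/-- The Hilbert space `H²(𝔻²) ⊕ (H²(𝔻) ⊕ ℂ)`. -/
abbrev BrownianSpace : Type := WithLp 2 (HardyBidisc × LowerSpace)

/-- The Brownian shift `(f, α) ↦ (S f + σ α, e^{iθ} α)` on `H²(𝔻) ⊕ ℂ`. -/
def brownianShift (σ θ : ℝ) : LowerSpace →L[ℂ] LowerSpace :=
  let π₁ := WithLp.fstL 2 ℂ (HardyDisc ℂ) ℂ
  let π₂ := WithLp.sndL 2 ℂ (HardyDisc ℂ) ℂ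
  (WithLp.prodContinuousLinearEquiv 2 ℂ (HardyDisc ℂ) ℂ).symm.toContinuousLinearMap ∘L
    ((hardyShift.toContinuousLinearMap ∘L π₁ +
        (σ : ℂ) • (hardyConst.toContinuousLinearMap ∘L π₂)).prod
      (Complex.exp (Complex.I * θ) • π₂))

/-- The 3-Brownian shift `(F, f, α) ↦ (M_{z₁} F + σ J f, S f + σ α, e^{iθ} α)`. -/
def threeBrownianShift (σ θ : ℝ) : BrownianSpace →L[ℂ] BrownianSpace :=
  let π₀ := WithLp.fstL 2 ℂ HardyBidisc LowerSpace
  let π₁₂ := WithLp.sndL 2 ℂ HardyBidisc LowerSpace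
  let π₁ := WithLp.fstL 2 ℂ (HardyDisc ℂ) ℂ
  (WithLp.prodContinuousLinearEquiv 2 ℂ HardyBidisc LowerSpace).symm.toContinuousLinearMap ∘L
    ((bidiscShift.toContinuousLinearMap ∘L π₀ +
        (σ : ℂ) • (bidiscEmbed.toContinuousLinearMap ∘L π₁ ∘L π₁₂)).prod
      (brownianShift σ θ ∘L π₁₂))

theorem threeBrownianShift_apply (σ θ : ℝ) (F : HardyBidisc) (f : HardyDisc ℂ) (α : ℂ) :
    threeBrownianShift σ θ (WithLp.toLp 2 (F, WithLp.toLp 2 (f, α))) =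
      WithLp.toLp 2 (bidiscShift F + (σ : ℂ) • bidiscEmbed f,
        WithLp.toLp 2 (hardyShift f + (σ : ℂ) • hardyConst α,
          Complex.exp (Complex.I * θ) * α)) := rfl

/-! ### Inner functions and model spaces -/

section Inner

variable {E : Type u} [NormedAddCommGroup E] [InnerProductSpace ℂ E] [CompleteSpace E]
variable {F : Type v} [NormedAddCommGroup F] [InnerProductSpace ℂ F] [CompleteSpace F]

/-- `Φ ∈ H^∞(𝔻; 𝓑(E, F))`: bounded and analytic on the open unit disc (the values of `Φ` outside
the disc are irrelevant). -/
def IsHInfty (Φ : ℂ → E →L[ℂ] F) : Prop :=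
  DifferentiableOn ℂ Φ (Metric.ball 0 1) ∧ ∃ C : ℝ, ∀ z : 𝔻, ‖Φ z‖ ≤ C

/-- `Φ` is an inner function: `Φ ∈ H^∞(𝔻; 𝓑(E, F))` and the multiplication operator
`M_Φ : H²(𝔻; E) → H²(𝔻; F)`, `(M_Φ f)(z) = Φ(z) f(z)`, is an isometry. -/
def IsInner (Φ : ℂ → E →L[ℂ] F) : Prop :=
  IsHInfty Φ ∧
    ∀ f : HardyDisc E, ∃ h : HardyDisc F, (∀ z : 𝔻, h z = Φ z (f z)) ∧ ‖h‖ = ‖f‖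

end Inner

/-- Scalar inner functions: `φ` acts on `ℂ` by multiplication. -/
def IsScalarInner (φ : ℂ → ℂ) : Prop :=
  IsInner fun z => φ z • ContinuousLinearMap.id ℂ ℂ

/-- The subspace `φ H²(𝔻)` of `H²(𝔻)`. -/
def innerRange (φ : ℂ → ℂ) : Submodule ℂ (HardyDisc ℂ) where
  carrier := {h | ∃ f : HardyDisc ℂ, ∀ z : 𝔻, h z = φ z * f z}
  zero_mem' := ⟨0, fun z => by simp⟩
  add_mem' := by
    rintro a b ⟨f, hf⟩ ⟨g, hg⟩
    exact ⟨f + g, fun z => by simp [hf, hg, mul_add]⟩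
  smul_mem' := by
    rintro c a ⟨f, hf⟩
    exact ⟨c • f, fun z => by simp [hf, mul_left_comm]⟩

/-- The model space `K_φ = H²(𝔻) ⊖ φ H²(𝔻)`. -/
abbrev ModelSpace (φ : ℂ → ℂ) : Submodule ℂ (HardyDisc ℂ) := (innerRange φ)ᗮ

/-- The subspace `φ_{z₂} H²(𝔻²)` of `H²(𝔻²)`, where `φ_{z₂}(z₁, z₂) = φ(z₂)`. -/
def bidiscInnerRange (φ : ℂ → ℂ) : Submodule ℂ HardyBidisc where
  carrier := {H | ∃ G : HardyBidisc, ∀ z w : 𝔻, H (z, w) = φ w * G (z, w)}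
  zero_mem' := ⟨0, fun z w => by simp⟩
  add_mem' := by
    rintro a b ⟨f, hf⟩ ⟨g, hg⟩
    exact ⟨f + g, fun z w => by simp [hf, hg, mul_add]⟩
  smul_mem' := by
    rintro c a ⟨f, hf⟩
    exact ⟨c • f, fun z w => by simp [hf, mul_left_comm]⟩

/-- The subspace `g_{z₂} H²_{z₁}(𝔻)` of `H²(𝔻²)`: the functions `(z₁, z₂) ↦ g(z₂) f(z₁)` with
`f ∈ H²(𝔻)`. -/
def bidiscTensorRange (g : HardyDisc ℂ) : Submodule ℂ HardyBidisc where
  carrier := {H | ∃ f : HardyDisc ℂ, ∀ z w : 𝔻, H (z, w) = g w * f z}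
  zero_mem' := ⟨0, fun z w => by simp⟩
  add_mem' := by
    rintro a b ⟨f, hf⟩ ⟨k, hk⟩
    exact ⟨f + k, fun z w => by simp [hf, hk, mul_add]⟩
  smul_mem' := by
    rintro c a ⟨f, hf⟩
    exact ⟨c • f, fun z w => by simp [hf, mul_left_comm]⟩

/-- The subspace `Ψ H²(𝔻; E)` of `H²(𝔻²)` for a function `Ψ` with values in `𝓑(E, K)`,
`K ⊆ H²(𝔻)`. Here `H²(𝔻²)` is identified with `H²(𝔻; H²(𝔻))` through the variable `z₁`, so that
`Ψ f` is the function `(z₁, z₂) ↦ (Ψ(z₁) f(z₁))(z₂)`. -/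
def bidiscOperatorRange {E : Type u} [NormedAddCommGroup E] [InnerProductSpace ℂ E]
    [CompleteSpace E] {K : Submodule ℂ (HardyDisc ℂ)} (Ψ : ℂ → E →L[ℂ] K) :
    Submodule ℂ HardyBidisc where
  carrier := {H | ∃ f : HardyDisc E, ∀ z w : 𝔻, H (z, w) = (Ψ z (f z) : HardyDisc ℂ) w}
  zero_mem' := ⟨0, fun z w => by simp⟩
  add_mem' := by
    rintro a b ⟨f, hf⟩ ⟨g, hg⟩
    exact ⟨f + g, fun z w => by simp [hf, hg]⟩
  smul_mem' := by
    rintro c a ⟨f, hf⟩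
    exact ⟨c • f, fun z w => by simp [hf]⟩

/-! ### Type I / II subspaces and their lifts -/

/-- The subspace `φ H²(𝔻) ⊕ {0}` of `H²(𝔻) ⊕ ℂ`. -/
def typeOneSubspace (φ : ℂ → ℂ) : Submodule ℂ LowerSpace where
  carrier := {x | x.fst ∈ innerRange φ ∧ x.snd = 0}
  zero_mem' := ⟨zero_mem _, rfl⟩
  add_mem' := by
    rintro a b ⟨ha, ha'⟩ ⟨hb, hb'⟩
    exact ⟨add_mem ha hb, by simp [ha', hb']⟩
  smul_mem' := by
    rintro c a ⟨ha, ha'⟩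
    exact ⟨Submodule.smul_mem _ c ha, by simp [ha']⟩

/-- The line `ℂ (g, 1)` in `H²(𝔻) ⊕ ℂ`. -/
def typeTwoLine (g : HardyDisc ℂ) : Submodule ℂ LowerSpace :=
  Submodule.span ℂ {WithLp.toLp 2 (g, (1 : ℂ))}

/-- `φ` and `g` are the data of a Type II invariant subspace of the Brownian shift with parameters
`σ`, `θ`: the function `φ` is inner, its boundary value `φ(e^{iθ})` exists, and
`g(z) = σ (conj φ(e^{iθ}) φ(z) - 1) / (z - e^{iθ})` is an element of `H²(𝔻)`. -/
def IsTypeTwoData (σ θ : ℝ) (φ : ℂ → ℂ) (g : HardyDisc ℂ) : Prop :=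
  IsScalarInner φ ∧
    ∃ c : ℂ,
      Filter.Tendsto (fun r : ℝ => φ (r * Complex.exp (Complex.I * θ))) (𝓝[<] 1) (𝓝 c) ∧
      ∀ z : 𝔻, g z = σ * ((conj c * φ z - 1) / (z - Complex.exp (Complex.I * θ)))

/-- The subspace `M₀ ⊕ M₁` of `H²(𝔻²) ⊕ (H²(𝔻) ⊕ ℂ)`. -/
def blockSubspace (M₀ : Submodule ℂ HardyBidisc) (M₁ : Submodule ℂ LowerSpace) :
    Submodule ℂ BrownianSpace where
  carrier := {x | x.fst ∈ M₀ ∧ x.snd ∈ M₁}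
  zero_mem' := ⟨zero_mem _, zero_mem _⟩
  add_mem' := fun ha hb => ⟨add_mem ha.1 hb.1, add_mem ha.2 hb.2⟩
  smul_mem' := fun c _ ha => ⟨Submodule.smul_mem _ c ha.1, Submodule.smul_mem _ c ha.2⟩

section Lifted

variable (E : Type u) [NormedAddCommGroup E] [InnerProductSpace ℂ E] [CompleteSpace E]

/-- `M` is a lifted Type I subspace with multiplicity space `E`:
`M = M₀ ⊕ M₁` with `M₁ = φ H²(𝔻) ⊕ {0}` and `M₀ = φ_{z₂} H²(𝔻²) ⊕ Ψ H²(𝔻; E)` (orthogonal sum)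
for some inner functions `φ ∈ H^∞(𝔻)` and `Ψ ∈ H^∞(𝔻; 𝓑(E, K_φ))`. -/
def IsLiftedTypeOne (M : Submodule ℂ BrownianSpace) : Prop :=
  ∃ (φ : ℂ → ℂ) (Ψ : ℂ → E →L[ℂ] ModelSpace φ),
    IsScalarInner φ ∧ IsInner Ψ ∧
    bidiscInnerRange φ ⟂ bidiscOperatorRange Ψ ∧
    M = blockSubspace (bidiscInnerRange φ ⊔ bidiscOperatorRange Ψ) (typeOneSubspace φ)

/-- `M` is a lifted Type II subspace (for the parameters `σ`, `θ`) with multiplicity space `E` and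
function `g`: `M = M₀ ⊕ M₁` with `M₁ = ℂ (g, 1) ⊕ (φ H²(𝔻) ⊕ {0})` and
`M₀ = φ_{z₂} H²(𝔻²) ⊕ g_{z₂} H²_{z₁}(𝔻) ⊕ Ψ H²(𝔻; E)` (orthogonal sums) for some inner functions
`φ ∈ H^∞(𝔻)` and `Ψ ∈ H^∞(𝔻; 𝓑(E, K_φ))` with `Ψ(0) E ⊆ g^⊥`, where `g` is the function
determined by `φ`, `σ` and `θ`. -/
def IsLiftedTypeTwo (σ θ : ℝ) (g : HardyDisc ℂ) (M : Submodule ℂ BrownianSpace) : Prop :=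
  ∃ (φ : ℂ → ℂ) (Ψ : ℂ → E →L[ℂ] ModelSpace φ),
    IsTypeTwoData σ θ φ g ∧ IsInner Ψ ∧
    (∀ e : E, ⟪g, (Ψ 0 e : HardyDisc ℂ)⟫_ℂ = 0) ∧
    typeTwoLine g ⟂ typeOneSubspace φ ∧
    bidiscInnerRange φ ⟂ bidiscTensorRange g ∧
    bidiscInnerRange φ ⟂ bidiscOperatorRange Ψ ∧
    bidiscTensorRange g ⟂ bidiscOperatorRange Ψ ∧
    M = blockSubspace (bidiscInnerRange φ ⊔ bidiscTensorRange g ⊔ bidiscOperatorRange Ψ)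
      (typeTwoLine g ⊔ typeOneSubspace φ)

/-- The (Hilbert space) dimension of `E`: the cardinality of an orthonormal basis. -/
def hilbertDim : Cardinal.{u} :=
  sInf {κ | ∃ s : Set E, Nonempty (HilbertBasis s ℂ E) ∧ Cardinal.mk s = κ}

end Lifted

/-- Unitary equivalence of the restrictions of `T₁`, `T₂` to invariant subspaces `M`, `N`: there is
a unitary `U : M → N` with `U T₁|_M = T₂|_N U`. -/
def RestrictionsUnitarilyEquivalent {H : Type*} [NormedAddCommGroup H] [InnerProductSpace ℂ H]
    (T₁ T₂ : H →L[ℂ] H) (M N : Submodule ℂ H)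
    (hM : ∀ x ∈ M, T₁ x ∈ M) (hN : ∀ x ∈ N, T₂ x ∈ N) : Prop :=
  ∃ U : M ≃ₗᵢ[ℂ] N, ∀ x : M, U ⟨T₁ x, hM x x.2⟩ = ⟨T₂ (U x), hN (U x) (U x).2⟩

end

/-! Write `T` for the 3-Brownian shift and `x = (F, f, α)`. The defects
`‖T x‖² - ‖x‖² = σ² ‖(f, α)‖²` and, for the lower part `B` of `T`,
`‖B (f, α)‖² - ‖(f, α)‖² = σ² |α|²` are determined by the norm and the operator, so a unitary
equivalence preserves `σ` (as `M` contains vectors with `F = 0`, `(f, α) ≠ 0`), then `‖(f, α)‖` and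
`|α|`. Hence it preserves the type (`α` vanishes on `M` exactly for Type I), `e^{iθ}` (by which `T`
acts on `α`) and `‖g‖` (the minimum of `‖(f, α)‖² / |α|²` is `1 + ‖g‖²`). The vectors of `M` with
`(f, α) = 0` that are orthogonal to `T M` form a copy of the multiplicity space `E`: they are the
`(Ψ e, 0, 0)` with `e ∈ E` (embedded as constants).

Conversely, both types have a parametrization by `H²(𝔻; Z) × H²(𝔻; E) × Z`, with `Z = H²(𝔻)` for
Type I and `Z = H²(𝔻) ⊕ ℂ` for Type II, in which `T` acts by an operator that depends only on `σ`
and, for Type II, `θ`, and the norm depends on nothing else but `‖g‖`. For Type II this rests on the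
identity `z g + σ = e^{iθ} g + σ c φ` with `c = conj φ(e^{iθ})`: together with `g ⟂ φ H²(𝔻)` it
forces `|c| = 1`, and it makes `(h, α) ↦ (c φ h + α g, α)` commute with `B`. -/

noncomputable section

section SquareSummable

variable {ι E : Type*} [NormedAddCommGroup E]

theorem memℓp_two_of_summable_norm_sq {a : ι → E} (ha : Summable fun i => ‖a i‖ ^ 2) :
    Memℓp a 2 :=
  memℓp_gen (by simpa using ha)

theorem lpTwo_norm_sq_eq_tsum (a : lp (fun _ : ι => E) 2) : ‖a‖ ^ 2 = ∑' i, ‖a i‖ ^ 2 := by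
  simpa using lp.norm_rpow_eq_tsum (p := 2) (by simp) a

end SquareSummable

namespace HardyDisc

variable {E : Type u} [NormedAddCommGroup E] [InnerProductSpace ℂ E] [CompleteSpace E]
variable {F : Type v} [NormedAddCommGroup F] [InnerProductSpace ℂ F] [CompleteSpace F]

section Coefficients

theorem summable_norm_sq_coeff (f : HardyDisc E) : Summable fun n => ‖coeff E f n‖ ^ 2 :=
  lpTwo_summable_sq _

theorem norm_sq_eq_tsum (f : HardyDisc E) : ‖f‖ ^ 2 = ∑' n, ‖coeff E f n‖ ^ 2 := by
  rw [← (coeff E).norm_map, lpTwo_norm_sq_eq_tsum]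

theorem exists_coeff_eq {a : ℕ → E} (ha : Summable fun n => ‖a n‖ ^ 2) :
    ∃ f : HardyDisc E, ∀ n, coeff E f n = a n :=
  ⟨(coeff E).symm ⟨a, memℓp_two_of_summable_norm_sq ha⟩, fun n => by
    rw [LinearIsometryEquiv.apply_symm_apply]⟩

theorem coeff_zero (f : HardyDisc E) : coeff E f 0 = f 0 := by
  have h := hasSum_single (f := fun n : ℕ => ((0 : 𝔻) : ℂ) ^ n • coeff E f n) 0 fun n hn => by
    rw [Complex.UnitDisc.coe_zero, zero_pow hn, zero_smul]
  simpa using (h.unique (f.hasSum_coeff 0))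

theorem hasSum_inner (f g : HardyDisc E) :
    HasSum (fun n => ⟪coeff E f n, coeff E g n⟫_ℂ) ⟪f, g⟫_ℂ := by
  rw [← (coeff E).inner_map_map]
  exact lp.hasSum_inner _ _

theorem exists_szegoKernel (w : 𝔻) : ∃ k : HardyDisc ℂ, ∀ f : HardyDisc ℂ, ⟪k, f⟫_ℂ = f w := by
  obtain ⟨k, hk⟩ := exists_coeff_eq (E := ℂ) (a := fun n => conj ((w : ℂ) ^ n))
    (by simpa using unitDisc_summable_sq w)
  refine ⟨k, fun f => (hasSum_inner k f).unique ?_⟩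
  refine (f.hasSum_coeff w).congr_fun fun n => ?_
  simp [hk, mul_comm]

end Coefficients

section Shift

variable (E)

theorem exists_shift (f : HardyDisc E) :
    ∃ h : HardyDisc E, h.1 = (fun z : 𝔻 => (z : ℂ) • f z) ∧ ‖h‖ = ‖f‖ := by
  obtain ⟨b, hb, hb0, hn⟩ := lpTwo_exists_extend Nat.succ_injective (coeff E f)
  obtain ⟨h, hh, hhn⟩ := exists_of_hasSum (F := fun z : 𝔻 => (z : ℂ) • f z) b fun z => by
    rw [← Function.Injective.hasSum_iff Nat.succ_injective fun k hk => by rw [hb0 k hk, smul_zero]]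
    refine ((f.hasSum_coeff z).const_smul (z : ℂ)).congr_fun fun n => ?_
    simp only [Function.comp_apply, hb, smul_smul, Nat.succ_eq_add_one, pow_succ']
  exact ⟨h, hh, by rw [hhn, hn, LinearIsometryEquiv.norm_map]⟩

/-- The unilateral shift `f ↦ z f` on `H²(𝔻; E)`; for `E = ℂ` it is `hardyShift`. -/
def shift : HardyDisc E →ₗᵢ[ℂ] HardyDisc E where
  toFun f := ⟨fun z => (z : ℂ) • f z, by
    obtain ⟨h, hh, -⟩ := exists_shift E f
    exact hh ▸ h.2⟩
  map_add' f g := ext fun z => smul_add (z : ℂ) (f z) (g z)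
  map_smul' c f := ext fun z => smul_comm (z : ℂ) c (f z)
  norm_map' f := by
    obtain ⟨h, hh, hn⟩ := exists_shift E f
    rw [← hn]
    exact congrArg norm (Subtype.ext hh.symm)

/-- The embedding of `E` into `H²(𝔻; E)` as the constant functions; for `E = ℂ` it is
`hardyConst`. -/
def const : E →ₗᵢ[ℂ] HardyDisc E :=
  (coeff E).symm.toLinearIsometry.comp
    { toLinearMap := lp.lsingle (E := fun _ : ℕ => E) 2 0
      norm_map' := fun c => lp.norm_single (E := fun _ : ℕ => E) two_pos 0 c }

variable {E}

@[simp] theorem shift_apply (f : HardyDisc E) (z : 𝔻) : shift E f z = (z : ℂ) • f z := rfl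

theorem coeff_const (c : E) : coeff E (const E c) = lp.single 2 0 c :=
  (coeff E).apply_symm_apply (lp.single 2 0 c)

@[simp] theorem const_apply (c : E) (z : 𝔻) : const E c z = c := by
  have h := hasSum_single (f := fun n : ℕ => (z : ℂ) ^ n • coeff E (const E c) n) 0 fun n hn => by
    rw [coeff_const, lp.single_apply_ne _ _ _ hn, smul_zero]
  rw [((const E c).hasSum_coeff z).unique h, coeff_const, pow_zero, one_smul, lp.single_apply_self]

theorem hardyShift_eq_shift : hardyShift = shift ℂ := rfl

theorem hardyConst_eq_const : hardyConst = const ℂ := by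
  ext c z
  exact (const_apply c z).symm

theorem inner_const_left (c : E) (f : HardyDisc E) : ⟪const E c, f⟫_ℂ = ⟪c, f 0⟫_ℂ := by
  rw [← (coeff E).inner_map_map, coeff_const, lp.inner_single_left, coeff_zero]

theorem inner_const_shift (c : E) (f : HardyDisc E) : ⟪const E c, shift E f⟫_ℂ = 0 := by
  simp [inner_const_left]

theorem exists_eq_const_add_shift (f : HardyDisc E) :
    ∃ g : HardyDisc E, f = const E (f 0) + shift E g := by
  obtain ⟨g, hg⟩ := exists_coeff_eq (E := E) (a := fun n => coeff E f (n + 1))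
    ((summable_nat_add_iff 1).2 f.summable_norm_sq_coeff)
  refine ⟨g, ext fun z => ?_⟩
  have hf := (hasSum_nat_add_iff' 1).2 (f.hasSum_coeff z)
  have hzg := (g.hasSum_coeff z).const_smul (z : ℂ)
  simp only [hg, smul_smul, ← pow_succ'] at hzg
  have heq := hf.unique hzg
  simp only [Finset.range_one, Finset.sum_singleton, pow_zero, one_smul, coeff_zero] at heq
  simp [← heq]

end Shift

section Map

theorem exists_map (V : E →L[ℂ] F) (f : HardyDisc E) :
    ∃ h : HardyDisc F, h.1 = (fun z => V (f z)) ∧ ∀ n, coeff F h n = V (coeff E f n) := by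
  obtain ⟨h, hh⟩ := exists_coeff_eq (E := F) (a := fun n => V (coeff E f n)) <|
    (f.summable_norm_sq_coeff.mul_left (‖V‖ ^ 2)).of_nonneg_of_le (fun _ => by positivity)
      fun n => by
        rw [← mul_pow]
        gcongr
        exact V.le_opNorm _
  refine ⟨h, funext fun z => (h.hasSum_coeff z).unique ?_, hh⟩
  simpa only [map_smul, ← hh] using V.hasSum (f.hasSum_coeff z)

/-- The operator `f ↦ V ∘ f` from `H²(𝔻; E)` to `H²(𝔻; F)`. -/
def map (V : E →L[ℂ] F) : HardyDisc E →ₗ[ℂ] HardyDisc F where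
  toFun f := ⟨fun z => V (f z), by
    obtain ⟨h, hh, -⟩ := exists_map V f
    exact hh ▸ h.2⟩
  map_add' f g := ext fun z => map_add V (f z) (g z)
  map_smul' c f := ext fun z => map_smul V c (f z)

theorem coeff_map (V : E →L[ℂ] F) (f : HardyDisc E) (n : ℕ) :
    coeff F (map V f) n = V (coeff E f n) := by
  obtain ⟨h, hh, hc⟩ := exists_map V f
  rw [← hc, show map V f = h from Subtype.ext hh.symm]

theorem norm_map_congr {F' : Type*} [NormedAddCommGroup F'] [InnerProductSpace ℂ F']
    [CompleteSpace F'] {V : E →L[ℂ] F} {V' : E →L[ℂ] F'} (h : ∀ x, ‖V x‖ = ‖V' x‖)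
    (f : HardyDisc E) : ‖map V f‖ = ‖map V' f‖ := by
  rw [← sq_eq_sq₀ (norm_nonneg _) (norm_nonneg _), norm_sq_eq_tsum, norm_sq_eq_tsum]
  simp only [coeff_map, h]

/-- The operator `f ↦ V ∘ f` for an isometry `V`. -/
def mapIsometry (V : E →ₗᵢ[ℂ] F) : HardyDisc E →ₗᵢ[ℂ] HardyDisc F where
  toLinearMap := map V.toContinuousLinearMap
  norm_map' := norm_map_congr (V' := ContinuousLinearMap.id ℂ E) V.norm_map

end Map

end HardyDisc

namespace HardyBidisc

theorem eq_and_norm_eq_of_coeff_eq {f : HardyDisc (HardyDisc ℂ)} {G : HardyBidisc}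
    (h : ∀ m n, HardyDisc.coeff ℂ (HardyDisc.coeff _ f m) n = coeff G (m, n)) :
    (∀ z w, G (z, w) = f z w) ∧ ‖G‖ = ‖f‖ := by
  constructor
  · intro z w
    obtain ⟨k, hk⟩ := HardyDisc.exists_szegoKernel w
    have hf := (innerSL ℂ k).hasSum (f.hasSum_coeff z)
    simp only [map_smul, innerSL_apply_apply, hk] at hf
    refine HasSum.unique ((G.hasSum_coeff (z, w)).prod_fiberwise fun m => ?_) hf
    refine (((HardyDisc.coeff _ f m).hasSum_coeff w).const_smul ((z : ℂ) ^ m)).congr_fun fun n => ?_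
    simp [h, mul_assoc]
  · rw [← sq_eq_sq₀ (norm_nonneg _) (norm_nonneg _), HardyDisc.norm_sq_eq_tsum,
      ← coeff.norm_map, lpTwo_norm_sq_eq_tsum, (lpTwo_summable_sq (coeff G)).tsum_prod]
    simp only [HardyDisc.norm_sq_eq_tsum, h]

theorem exists_of_hardyDisc (f : HardyDisc (HardyDisc ℂ)) :
    ∃ G : HardyBidisc, (∀ z w, G (z, w) = f z w) ∧ ‖G‖ = ‖f‖ := by
  obtain ⟨a, ha⟩ : ∃ a : ℕ × ℕ → ℂ,
      ∀ m n, a (m, n) = HardyDisc.coeff ℂ (HardyDisc.coeff _ f m) n :=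
    ⟨fun k => HardyDisc.coeff ℂ (HardyDisc.coeff _ f k.1) k.2, fun _ _ => rfl⟩
  have hs : Summable fun k => ‖a k‖ ^ 2 := by
    refine (summable_prod_of_nonneg fun _ => by positivity).2 ⟨fun m => ?_, ?_⟩
    · simpa only [ha] using HardyDisc.summable_norm_sq_coeff (HardyDisc.coeff _ f m)
    · simpa only [ha, ← HardyDisc.norm_sq_eq_tsum] using f.summable_norm_sq_coeff
  refine ⟨coeff.symm ⟨a, memℓp_two_of_summable_norm_sq hs⟩,
    eq_and_norm_eq_of_coeff_eq fun m n => ?_⟩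
  rw [LinearIsometryEquiv.apply_symm_apply, ← ha]

theorem exists_hardyDisc (G : HardyBidisc) :
    ∃ f : HardyDisc (HardyDisc ℂ), ∀ z w, G (z, w) = f z w := by
  have hs := (summable_prod_of_nonneg fun _ => by positivity).1 (lpTwo_summable_sq (coeff G))
  choose a ha using fun m => HardyDisc.exists_coeff_eq (E := ℂ) (a := fun n => coeff G (m, n))
    (hs.1 m)
  obtain ⟨f, hf⟩ := HardyDisc.exists_coeff_eq (E := HardyDisc ℂ) (a := a)
    (by simpa only [HardyDisc.norm_sq_eq_tsum, ha] using hs.2)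
  exact ⟨f, (eq_and_norm_eq_of_coeff_eq fun m n => by rw [hf, ha]).1⟩

/-- The identification of `H²(𝔻; H²(𝔻))` with `H²(𝔻²)` through the first variable. -/
def ofHardyDisc : HardyDisc (HardyDisc ℂ) ≃ₗᵢ[ℂ] HardyBidisc :=
  LinearIsometryEquiv.ofSurjective
    { toFun := fun f => ⟨fun p => f p.1 p.2, by
        obtain ⟨h, hh, -⟩ := exists_of_hardyDisc f
        have : h.1 = fun p : 𝔻 × 𝔻 => f p.1 p.2 := funext fun p => hh p.1 p.2
        exact this ▸ h.2⟩
      map_add' := fun _ _ => rfl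
      map_smul' := fun _ _ => rfl
      norm_map' := fun f => by
        obtain ⟨h, hh, hn⟩ := exists_of_hardyDisc f
        rw [← hn]
        exact congrArg norm (ext fun p => (hh p.1 p.2).symm) }
    fun G => by
      obtain ⟨f, hf⟩ := exists_hardyDisc G
      exact ⟨f, ext fun p => (hf p.1 p.2).symm⟩

@[simp] theorem bidiscShift_apply (F : HardyBidisc) (z w : 𝔻) :
    bidiscShift F (z, w) = z * F (z, w) := rfl

@[simp] theorem bidiscEmbed_apply (f : HardyDisc ℂ) (z w : 𝔻) :
    bidiscEmbed f (z, w) = f w := rfl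

theorem ofHardyDisc_shift (f : HardyDisc (HardyDisc ℂ)) :
    ofHardyDisc (HardyDisc.shift _ f) = bidiscShift (ofHardyDisc f) := rfl

theorem ofHardyDisc_const (f : HardyDisc ℂ) :
    ofHardyDisc (HardyDisc.const _ f) = bidiscEmbed f :=
  ext fun p => congrArg (fun h : HardyDisc ℂ => h p.2) (HardyDisc.const_apply f p.1)

theorem inner_bidiscEmbed_bidiscShift (f : HardyDisc ℂ) (F : HardyBidisc) :
    ⟪bidiscEmbed f, bidiscShift F⟫_ℂ = 0 := by
  obtain ⟨F, rfl⟩ := ofHardyDisc.surjective F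
  rw [← ofHardyDisc_shift, ← ofHardyDisc_const, LinearIsometryEquiv.inner_map_map,
    HardyDisc.inner_const_shift]

end HardyBidisc

section BidiscLift

variable {Z : Type u} [NormedAddCommGroup Z] [InnerProductSpace ℂ Z] [CompleteSpace Z]

/-- The operator `1 ⊗ ℓ : H²(𝔻; Z) → H²(𝔻²)` which applies `ℓ : Z → H²(𝔻)` in the variable
`z₂`: it sends `y` to `(z₁, z₂) ↦ ℓ (y z₁) z₂`. -/
def bidiscLift (ℓ : Z →L[ℂ] HardyDisc ℂ) : HardyDisc Z →ₗ[ℂ] HardyBidisc :=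
  HardyBidisc.ofHardyDisc.toLinearMap ∘ₗ HardyDisc.map ℓ

@[simp] theorem bidiscLift_apply (ℓ : Z →L[ℂ] HardyDisc ℂ) (y : HardyDisc Z) (z w : 𝔻) :
    bidiscLift ℓ y (z, w) = ℓ (y z) w := rfl

theorem bidiscLift_shift (ℓ : Z →L[ℂ] HardyDisc ℂ) (y : HardyDisc Z) :
    bidiscLift ℓ (HardyDisc.shift Z y) = bidiscShift (bidiscLift ℓ y) := by
  ext ⟨z, w⟩
  simp

theorem bidiscLift_const (ℓ : Z →L[ℂ] HardyDisc ℂ) (x : Z) :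
    bidiscLift ℓ (HardyDisc.const Z x) = bidiscEmbed (ℓ x) := by
  ext ⟨z, w⟩
  simp

theorem norm_bidiscLift_congr {ℓ ℓ' : Z →L[ℂ] HardyDisc ℂ} (h : ∀ x, ‖ℓ x‖ = ‖ℓ' x‖)
    (y : HardyDisc Z) : ‖bidiscLift ℓ y‖ = ‖bidiscLift ℓ' y‖ := by
  simpa only [bidiscLift, LinearMap.comp_apply, LinearIsometryEquiv.coe_toLinearEquiv,
    LinearEquiv.coe_coe, LinearIsometryEquiv.norm_map] using HardyDisc.norm_map_congr h y

end BidiscLift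

section BrownianShift

theorem norm_sq_add_smul_of_inner_eq_zero {H : Type*} [NormedAddCommGroup H]
    [InnerProductSpace ℂ H] {x y : H} (h : ⟪y, x⟫_ℂ = 0) (c : ℂ) :
    ‖x + c • y‖ ^ 2 = ‖x‖ ^ 2 + ‖c‖ ^ 2 * ‖y‖ ^ 2 := by
  have h' : ⟪x, c • y⟫_ℂ = 0 := by rw [inner_smul_right, inner_eq_zero_symm.1 h, mul_zero]
  rw [sq, norm_add_sq_eq_norm_sq_add_norm_sq_of_inner_eq_zero x (c • y) h', norm_smul]
  ring

theorem inner_hardyConst_hardyShift (α : ℂ) (f : HardyDisc ℂ) :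
    ⟪hardyConst α, hardyShift f⟫_ℂ = 0 := by
  rw [HardyDisc.hardyShift_eq_shift, HardyDisc.hardyConst_eq_const, HardyDisc.inner_const_shift]

variable (σ θ : ℝ)

theorem brownianShift_fst (y : LowerSpace) :
    (brownianShift σ θ y).fst = hardyShift y.fst + (σ : ℂ) • hardyConst y.snd := rfl

theorem brownianShift_snd (y : LowerSpace) :
    (brownianShift σ θ y).snd = Complex.exp (Complex.I * θ) * y.snd := rfl

theorem threeBrownianShift_fst (x : BrownianSpace) :
    (threeBrownianShift σ θ x).fst = bidiscShift x.fst + (σ : ℂ) • bidiscEmbed x.snd.fst := rfl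

theorem threeBrownianShift_snd (x : BrownianSpace) :
    (threeBrownianShift σ θ x).snd = brownianShift σ θ x.snd := rfl

theorem norm_sq_brownianShift (y : LowerSpace) :
    ‖brownianShift σ θ y‖ ^ 2 = ‖y‖ ^ 2 + σ ^ 2 * ‖y.snd‖ ^ 2 := by
  rw [WithLp.prod_norm_sq_eq_of_L2, WithLp.prod_norm_sq_eq_of_L2, brownianShift_fst,
    brownianShift_snd, norm_mul, Complex.norm_exp_I_mul_ofReal, norm_sq_add_smul_of_inner_eq_zero,
    hardyShift.norm_map, hardyConst.norm_map, Complex.norm_real, Real.norm_eq_abs, sq_abs]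
  · ring
  · exact inner_hardyConst_hardyShift _ _

theorem norm_sq_threeBrownianShift (x : BrownianSpace) :
    ‖threeBrownianShift σ θ x‖ ^ 2 = ‖x‖ ^ 2 + σ ^ 2 * ‖x.snd‖ ^ 2 := by
  rw [WithLp.prod_norm_sq_eq_of_L2 (threeBrownianShift σ θ x), WithLp.prod_norm_sq_eq_of_L2 x,
    threeBrownianShift_fst, threeBrownianShift_snd, norm_sq_brownianShift,
    norm_sq_add_smul_of_inner_eq_zero, bidiscShift.norm_map, bidiscEmbed.norm_map,
    WithLp.prod_norm_sq_eq_of_L2 x.snd, Complex.norm_real, Real.norm_eq_abs, sq_abs]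
  · ring
  · exact HardyBidisc.inner_bidiscEmbed_bidiscShift _ _

end BrownianShift

section Multipliers

variable {E : Type u} [NormedAddCommGroup E] [InnerProductSpace ℂ E] [CompleteSpace E]
variable {F : Type v} [NormedAddCommGroup F] [InnerProductSpace ℂ F] [CompleteSpace F]

/-- The multiplication operator `M_Ψ : H²(𝔻; E) → H²(𝔻; F)` of an inner function `Ψ`. -/
def IsInner.mulIsometry {Ψ : ℂ → E →L[ℂ] F} (hΨ : IsInner Ψ) : HardyDisc E →ₗᵢ[ℂ] HardyDisc F where
  toFun f := ⟨fun z => Ψ z (f z), by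
    obtain ⟨h, hh, -⟩ := hΨ.2 f
    have : h.1 = fun z : 𝔻 => Ψ z (f z) := funext hh
    exact this ▸ h.2⟩
  map_add' f g := HardyDisc.ext fun z => map_add (Ψ z) (f z) (g z)
  map_smul' c f := HardyDisc.ext fun z => map_smul (Ψ z) c (f z)
  norm_map' f := by
    obtain ⟨h, hh, hn⟩ := hΨ.2 f
    rw [← hn]
    exact congrArg norm (HardyDisc.ext fun z => (hh z).symm)

variable {φ : ℂ → ℂ}

/-- The multiplication operator `M_φ` on `H²(𝔻)` of a scalar inner function `φ`. -/
def innerMul (hφ : IsScalarInner φ) : HardyDisc ℂ →ₗᵢ[ℂ] HardyDisc ℂ :=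
  IsInner.mulIsometry hφ

theorem range_innerMul (hφ : IsScalarInner φ) :
    LinearMap.range (innerMul hφ).toLinearMap = innerRange φ :=
  Submodule.ext fun _ => exists_congr fun _ =>
    ⟨fun h z => by rw [← h]; rfl, fun h => HardyDisc.ext fun z => (h z).symm⟩

theorem range_bidiscLift_innerMul (hφ : IsScalarInner φ) :
    LinearMap.range (bidiscLift (innerMul hφ).toContinuousLinearMap) = bidiscInnerRange φ := by
  ext H
  constructor
  · rintro ⟨y, rfl⟩
    exact ⟨HardyBidisc.ofHardyDisc y, fun _ _ => rfl⟩
  · rintro ⟨G, hG⟩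
    obtain ⟨y, rfl⟩ := HardyBidisc.ofHardyDisc.surjective G
    exact ⟨y, HardyBidisc.ext fun p => (hG p.1 p.2).symm⟩

theorem range_bidiscLift_toSpanSingleton (g : HardyDisc ℂ) :
    LinearMap.range (bidiscLift (ContinuousLinearMap.toSpanSingleton ℂ g)) =
      bidiscTensorRange g :=
  Submodule.ext fun _ => exists_congr fun f =>
    ⟨fun h z w => by rw [← h]; exact mul_comm (f z) (g w),
      fun h => HardyBidisc.ext fun p => (mul_comm (f p.1) (g p.2)).trans (h p.1 p.2).symm⟩

/-- The operator `f ↦ Ψ f` from `H²(𝔻; E)` to `H²(𝔻²)` for an inner function `Ψ` with values in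
`𝓑(E, K_φ)`. -/
def bidiscOperatorMul {Ψ : ℂ → E →L[ℂ] ModelSpace φ} (hΨ : IsInner Ψ) :
    HardyDisc E →ₗᵢ[ℂ] HardyBidisc :=
  (HardyBidisc.ofHardyDisc.toLinearIsometry.comp
    (HardyDisc.mapIsometry (ModelSpace φ).subtypeₗᵢ)).comp hΨ.mulIsometry

theorem bidiscOperatorMul_shift {Ψ : ℂ → E →L[ℂ] ModelSpace φ} (hΨ : IsInner Ψ)
    (u : HardyDisc E) :
    bidiscOperatorMul hΨ (HardyDisc.shift E u) = bidiscShift (bidiscOperatorMul hΨ u) :=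
  HardyBidisc.ext fun p =>
    congrArg (fun x : ModelSpace φ => (x : HardyDisc ℂ) p.2) (map_smul (Ψ p.1) (p.1 : ℂ) (u p.1))

theorem range_bidiscOperatorMul {Ψ : ℂ → E →L[ℂ] ModelSpace φ} (hΨ : IsInner Ψ) :
    LinearMap.range (bidiscOperatorMul hΨ).toLinearMap = bidiscOperatorRange Ψ :=
  Submodule.ext fun _ => exists_congr fun _ =>
    ⟨fun h z w => by rw [← h]; rfl, fun h => HardyBidisc.ext fun p => (h p.1 p.2).symm⟩

end Multipliers

local notation "π₁" => WithLp.fstL 2 ℂ (HardyDisc ℂ) ℂ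

section LiftedModel

variable {E : Type u} [NormedAddCommGroup E] [InnerProductSpace ℂ E] [CompleteSpace E]
variable {Z : Type*} [NormedAddCommGroup Z] [InnerProductSpace ℂ Z] [CompleteSpace Z]

/-- A description of `M = M₀ ⊕ M₁` in which both types of lifted subspaces take the same form:
`q` parametrizes `M₁` by a Hilbert space `Z`, and `M₀` is the orthogonal sum of the range of
`1 ⊗ π₁ q` (which is `φ_{z₂} H²(𝔻²)`, together with `g_{z₂} H²_{z₁}(𝔻)` for Type II) and the range
of an isometry `W` that intertwines the shift of `H²(𝔻; E)` with `M_{z₁}` (which is `M_Ψ`). -/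
structure IsLiftedModel (q : Z →L[ℂ] LowerSpace) (W : HardyDisc E →ₗᵢ[ℂ] HardyBidisc)
    (M : Submodule ℂ BrownianSpace) : Prop where
  map_shift : ∀ u, W (HardyDisc.shift E u) = bidiscShift (W u)
  isOrtho : LinearMap.range (bidiscLift (π₁ ∘L q)) ⟂ LinearMap.range W.toLinearMap
  eq_blockSubspace : M = blockSubspace
    (LinearMap.range (bidiscLift (π₁ ∘L q)) ⊔ LinearMap.range W.toLinearMap)
    (LinearMap.range q.toLinearMap)

namespace IsLiftedModel

variable {q : Z →L[ℂ] LowerSpace} {W : HardyDisc E →ₗᵢ[ℂ] HardyBidisc}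
variable {M : Submodule ℂ BrownianSpace}

theorem mem_iff (h : IsLiftedModel q W M) {x : BrownianSpace} :
    x ∈ M ↔ (∃ y u, bidiscLift (π₁ ∘L q) y + W u = x.fst) ∧ ∃ z, q z = x.snd := by
  rw [h.eq_blockSubspace]
  refine and_congr_left fun _ => ⟨fun hx => ?_, ?_⟩
  · obtain ⟨_, ⟨y, rfl⟩, _, ⟨u, rfl⟩, hyu⟩ := Submodule.mem_sup.1 hx
    exact ⟨y, u, hyu⟩
  · rintro ⟨y, u, hyu⟩
    exact hyu ▸ Submodule.add_mem_sup ⟨y, rfl⟩ ⟨u, rfl⟩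

theorem toLp_mem (h : IsLiftedModel q W M) (y : HardyDisc Z) (u : HardyDisc E) (z : Z) :
    WithLp.toLp 2 (bidiscLift (π₁ ∘L q) y + W u, q z) ∈ M :=
  h.mem_iff.2 ⟨⟨y, u, rfl⟩, z, rfl⟩

theorem inner_bidiscLift_eq_zero (h : IsLiftedModel q W M) (y : HardyDisc Z) (u : HardyDisc E) :
    ⟪bidiscLift (π₁ ∘L q) y, W u⟫_ℂ = 0 :=
  Submodule.isOrtho_iff_inner_eq.1 h.isOrtho _ ⟨y, rfl⟩ _ ⟨u, rfl⟩

theorem comp_mapIsometry {E' : Type*} [NormedAddCommGroup E'] [InnerProductSpace ℂ E']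
    [CompleteSpace E'] (h : IsLiftedModel q W M) (V : E' ≃ₗᵢ[ℂ] E) :
    IsLiftedModel q (W.comp (HardyDisc.mapIsometry V.toLinearIsometry)) M := by
  have hsurj : Function.Surjective (HardyDisc.mapIsometry V.toLinearIsometry) := fun u =>
    ⟨HardyDisc.mapIsometry V.symm.toLinearIsometry u, HardyDisc.ext fun z => V.apply_symm_apply _⟩
  have hrange : LinearMap.range
      (W.comp (HardyDisc.mapIsometry V.toLinearIsometry)).toLinearMap =
        LinearMap.range W.toLinearMap :=
    LinearMap.range_comp_of_range_eq_top _ (LinearMap.range_eq_top.2 hsurj)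
  refine ⟨fun u => ?_, hrange ▸ h.isOrtho, hrange ▸ h.eq_blockSubspace⟩
  have hshift : HardyDisc.mapIsometry V.toLinearIsometry (HardyDisc.shift E' u) =
      HardyDisc.shift E (HardyDisc.mapIsometry V.toLinearIsometry u) :=
    HardyDisc.ext fun z => map_smul V (z : ℂ) (u z)
  exact (congrArg W hshift).trans (h.map_shift _)

section Wandering

variable {σ θ : ℝ}

theorem threeBrownianShift_fst_eq (h : IsLiftedModel q W M) {x : BrownianSpace} {y : HardyDisc Z}
    {u : HardyDisc E} {z : Z} (hyu : bidiscLift (π₁ ∘L q) y + W u = x.fst) (hz : q z = x.snd) :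
    (threeBrownianShift σ θ x).fst =
      bidiscLift (π₁ ∘L q) (HardyDisc.shift Z y + (σ : ℂ) • HardyDisc.const Z z) +
        W (HardyDisc.shift E u) := by
  rw [threeBrownianShift_fst, ← hyu, ← hz, map_add, map_add, map_smul, bidiscLift_shift,
    bidiscLift_const, h.map_shift]
  exact add_right_comm _ _ _

theorem inner_threeBrownianShift_const (h : IsLiftedModel q W M) {x : BrownianSpace} (hx : x ∈ M)
    (e : E) : ⟪(threeBrownianShift σ θ x).fst, W (HardyDisc.const E e)⟫_ℂ = 0 := by
  obtain ⟨⟨y, u, hyu⟩, z, hz⟩ := h.mem_iff.1 hx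
  rw [h.threeBrownianShift_fst_eq hyu hz, inner_add_left, h.inner_bidiscLift_eq_zero, zero_add,
    W.inner_map_map, inner_eq_zero_symm, HardyDisc.inner_const_shift]

theorem exists_threeBrownianShift_fst_eq (h : IsLiftedModel q W M) (hσ : σ ≠ 0) (y : HardyDisc Z) :
    ∃ x ∈ M, (threeBrownianShift σ θ x).fst = bidiscLift (π₁ ∘L q) y := by
  obtain ⟨y', hy'⟩ := y.exists_eq_const_add_shift
  refine ⟨_, h.toLp_mem y' 0 ((σ : ℂ)⁻¹ • y 0), ?_⟩
  rw [h.threeBrownianShift_fst_eq rfl rfl, ← map_smul,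
    smul_inv_smul₀ (Complex.ofReal_ne_zero.2 hσ), add_comm (HardyDisc.shift Z y'), ← hy', map_zero,
    map_zero, add_zero]

theorem exists_const_iff (h : IsLiftedModel q W M) (hσ : σ ≠ 0) {x : BrownianSpace} (hx : x ∈ M) :
    (∃ e : E, WithLp.toLp 2 (W (HardyDisc.const E e), (0 : LowerSpace)) = x) ↔
      x.snd = 0 ∧ ∀ y ∈ M, ⟪threeBrownianShift σ θ y, x⟫_ℂ = 0 := by
  constructor
  · rintro ⟨e, rfl⟩
    refine ⟨rfl, fun y hy => ?_⟩
    rw [WithLp.prod_inner_apply]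
    simpa using h.inner_threeBrownianShift_const hy e
  · rintro ⟨hsnd, hwand⟩
    have hinner : ∀ y ∈ M, ⟪(threeBrownianShift σ θ y).fst, x.fst⟫_ℂ = 0 := fun y hy => by
      simpa [WithLp.prod_inner_apply, hsnd] using hwand y hy
    obtain ⟨⟨a, u, hau⟩, -⟩ := h.mem_iff.1 hx
    have ha : bidiscLift (π₁ ∘L q) a = 0 := by
      obtain ⟨y, hy, hya⟩ := h.exists_threeBrownianShift_fst_eq (θ := θ) hσ a
      simpa [hya, ← hau, inner_add_right, h.inner_bidiscLift_eq_zero] using hinner y hy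
    obtain ⟨u', hu⟩ := u.exists_eq_const_add_shift
    have hu' : HardyDisc.shift E u' = 0 := by
      have := hinner _ (h.toLp_mem 0 u' 0)
      rwa [h.threeBrownianShift_fst_eq rfl rfl, map_zero, map_zero, smul_zero, add_zero, map_zero,
        zero_add, ← hau, ha, zero_add, W.inner_map_map, hu, inner_add_right,
        inner_eq_zero_symm.1 (HardyDisc.inner_const_shift _ _), zero_add,
        inner_self_eq_zero] at this
    rw [hu', add_zero] at hu
    have hfst : W (HardyDisc.const E (u 0)) = x.fst := by rw [← hu, ← hau, ha, zero_add]
    exact ⟨u 0, WithLp.ofLp_injective 2 (Prod.ext hfst hsnd.symm)⟩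

theorem exists_wanderingEmbedding (h : IsLiftedModel q W M) (hσ : σ ≠ 0) :
    ∃ V : E →ₗᵢ[ℂ] M, ∀ x : M, x ∈ Set.range V ↔
      x.1.snd = 0 ∧ ∀ y ∈ M, ⟪threeBrownianShift σ θ y, x⟫_ℂ = 0 := by
  have hmem : ∀ e, WithLp.toLp 2 (W (HardyDisc.const E e), (0 : LowerSpace)) ∈ M := fun e => by
    simpa using h.toLp_mem 0 (HardyDisc.const E e) 0
  refine ⟨
    { toFun := fun e => ⟨WithLp.toLp 2 (W (HardyDisc.const E e), 0), hmem e⟩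
      map_add' := fun a b => Subtype.ext (WithLp.ofLp_injective 2 (by simp))
      map_smul' := fun c a => Subtype.ext (WithLp.ofLp_injective 2 (by simp))
      norm_map' := fun e => ?_ }, fun x => ?_⟩
  · change ‖WithLp.toLp 2 (W (HardyDisc.const E e), (0 : LowerSpace))‖ = ‖e‖
    simp
  · rw [← h.exists_const_iff hσ x.2]
    exact exists_congr fun e => Subtype.ext_iff

end Wandering

end IsLiftedModel

end LiftedModel

section BidiscLiftRange

variable {Z : Type u} [NormedAddCommGroup Z] [InnerProductSpace ℂ Z] [CompleteSpace Z]

theorem range_bidiscLift_smul (ℓ : Z →L[ℂ] HardyDisc ℂ) {a : ℂ} (ha : a ≠ 0) :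
    LinearMap.range (bidiscLift (a • ℓ)) = LinearMap.range (bidiscLift ℓ) :=
  LinearMap.range_smul (bidiscLift ℓ) a ha

theorem range_bidiscLift_add {Y : Type v} [NormedAddCommGroup Y] [InnerProductSpace ℂ Y]
    [CompleteSpace Y] (ℓ : Z →L[ℂ] HardyDisc ℂ) (ℓ' : Y →L[ℂ] HardyDisc ℂ) :
    LinearMap.range
        (bidiscLift (ℓ ∘L WithLp.fstL 2 ℂ Z Y + ℓ' ∘L WithLp.sndL 2 ℂ Z Y)) =
      LinearMap.range (bidiscLift ℓ) ⊔ LinearMap.range (bidiscLift ℓ') := by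
  let ι := (WithLp.prodContinuousLinearEquiv 2 ℂ Z Y).symm.toContinuousLinearMap
  apply le_antisymm
  · rintro _ ⟨y, rfl⟩
    exact Submodule.mem_sup.2 ⟨_, ⟨HardyDisc.map (WithLp.fstL 2 ℂ Z Y) y, rfl⟩, _,
      ⟨HardyDisc.map (WithLp.sndL 2 ℂ Z Y) y, rfl⟩, rfl⟩
  · refine sup_le ?_ ?_
    · rintro _ ⟨y, rfl⟩
      refine ⟨HardyDisc.map (ι ∘L ContinuousLinearMap.inl ℂ Z Y) y, HardyBidisc.ext fun p => ?_⟩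
      change (ℓ (y p.1) + ℓ' 0) p.2 = ℓ (y p.1) p.2
      rw [map_zero, add_zero]
    · rintro _ ⟨y, rfl⟩
      refine ⟨HardyDisc.map (ι ∘L ContinuousLinearMap.inr ℂ Z Y) y, HardyBidisc.ext fun p => ?_⟩
      change (ℓ 0 + ℓ' (y p.1)) p.2 = ℓ' (y p.1) p.2
      rw [map_zero, zero_add]

end BidiscLiftRange

section TypeOne

variable {E : Type u} [NormedAddCommGroup E] [InnerProductSpace ℂ E] [CompleteSpace E]
variable {φ : ℂ → ℂ}

/-- The parametrization `h ↦ (φ h, 0)` of the lower component `φ H²(𝔻) ⊕ {0}` of a lifted Type I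
subspace. -/
def typeOneMap (hφ : IsScalarInner φ) : HardyDisc ℂ →L[ℂ] LowerSpace :=
  (WithLp.prodContinuousLinearEquiv 2 ℂ (HardyDisc ℂ) ℂ).symm.toContinuousLinearMap ∘L
    ContinuousLinearMap.inl ℂ (HardyDisc ℂ) ℂ ∘L (innerMul hφ).toContinuousLinearMap

theorem typeOneMap_fst (hφ : IsScalarInner φ) (h : HardyDisc ℂ) :
    (typeOneMap hφ h).fst = innerMul hφ h := rfl

theorem typeOneMap_snd (hφ : IsScalarInner φ) (h : HardyDisc ℂ) : (typeOneMap hφ h).snd = 0 := rfl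

theorem range_typeOneMap (hφ : IsScalarInner φ) :
    LinearMap.range (typeOneMap hφ).toLinearMap = typeOneSubspace φ := by
  ext x
  change _ ↔ x.fst ∈ innerRange φ ∧ x.snd = 0
  rw [← range_innerMul hφ]
  constructor
  · rintro ⟨h, rfl⟩
    exact ⟨⟨h, rfl⟩, rfl⟩
  · rintro ⟨⟨h, hh⟩, hx⟩
    exact ⟨h, WithLp.ofLp_injective 2 (Prod.ext hh hx.symm)⟩

theorem brownianShift_typeOneMap (hφ : IsScalarInner φ) (σ θ : ℝ) (h : HardyDisc ℂ) :
    brownianShift σ θ (typeOneMap hφ h) = typeOneMap hφ (hardyShift h) := by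
  refine WithLp.ofLp_injective 2 (Prod.ext (HardyDisc.ext fun z => ?_) (mul_zero _))
  change z * (φ z * h z) + σ * 0 = φ z * (z * h z)
  ring

theorem IsLiftedTypeOne.exists_isLiftedModel {M : Submodule ℂ BrownianSpace}
    (h : IsLiftedTypeOne E M) :
    ∃ (q : HardyDisc ℂ →L[ℂ] LowerSpace) (W : HardyDisc E →ₗᵢ[ℂ] HardyBidisc),
      IsLiftedModel q W M ∧ (∀ f, ‖(q f).fst‖ = ‖f‖) ∧ (∀ f, (q f).snd = 0) ∧
        ∀ σ θ f, brownianShift σ θ (q f) = q (hardyShift f) := by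
  obtain ⟨φ, Ψ, hφ, hΨ, hφΨ, hM⟩ := h
  have hrange : LinearMap.range (bidiscLift (π₁ ∘L typeOneMap hφ)) = bidiscInnerRange φ :=
    range_bidiscLift_innerMul hφ
  refine ⟨typeOneMap hφ, bidiscOperatorMul hΨ, ⟨bidiscOperatorMul_shift hΨ, ?_, ?_⟩,
    (innerMul hφ).norm_map, typeOneMap_snd hφ, brownianShift_typeOneMap hφ⟩
  · rwa [hrange, range_bidiscOperatorMul]
  · rw [hrange, range_bidiscOperatorMul, range_typeOneMap, hM]

end TypeOne

section TypeTwo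

variable {E : Type u} [NormedAddCommGroup E] [InnerProductSpace ℂ E] [CompleteSpace E]
variable {φ : ℂ → ℂ} {g : HardyDisc ℂ} {c : ℂ} {σ θ : ℝ}

/-- The parametrization `(h, α) ↦ (c φ h + α g, α)` of the lower component
`ℂ (g, 1) ⊕ (φ H²(𝔻) ⊕ {0})` of a lifted Type II subspace. For `c = conj φ(e^{iθ})` it commutes
with the Brownian shift. -/
def typeTwoMap (hφ : IsScalarInner φ) (g : HardyDisc ℂ) (c : ℂ) : LowerSpace →L[ℂ] LowerSpace :=
  (WithLp.prodContinuousLinearEquiv 2 ℂ (HardyDisc ℂ) ℂ).symm.toContinuousLinearMap ∘L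
    ((c • (innerMul hφ).toContinuousLinearMap) ∘L WithLp.fstL 2 ℂ (HardyDisc ℂ) ℂ +
      ContinuousLinearMap.toSpanSingleton ℂ g ∘L WithLp.sndL 2 ℂ (HardyDisc ℂ) ℂ).prod
      (WithLp.sndL 2 ℂ (HardyDisc ℂ) ℂ)

theorem typeTwoMap_fst (hφ : IsScalarInner φ) (x : LowerSpace) :
    (typeTwoMap hφ g c x).fst = c • innerMul hφ x.fst + x.snd • g := rfl

theorem typeTwoMap_snd (hφ : IsScalarInner φ) (x : LowerSpace) :
    (typeTwoMap hφ g c x).snd = x.snd := rfl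

theorem range_typeTwoMap (hφ : IsScalarInner φ) (hc : c ≠ 0) :
    LinearMap.range (typeTwoMap hφ g c).toLinearMap = typeTwoLine g ⊔ typeOneSubspace φ := by
  rw [← range_typeOneMap hφ]
  apply le_antisymm
  · rintro _ ⟨x, rfl⟩
    refine Submodule.mem_sup.2 ⟨_, Submodule.mem_span_singleton.2 ⟨x.snd, rfl⟩, _,
      ⟨c • x.fst, rfl⟩, WithLp.ofLp_injective 2 (Prod.ext ?_ ?_)⟩
    · exact (add_comm _ _).trans (congrArg (· + _) (map_smul (innerMul hφ) c x.fst))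
    · change x.snd * 1 + 0 = x.snd
      ring
  · refine sup_le ((Submodule.span_singleton_le_iff_mem _ _).2 ⟨WithLp.toLp 2 (0, 1), ?_⟩) ?_
    · refine WithLp.ofLp_injective 2 (Prod.ext ?_ rfl)
      change c • innerMul hφ 0 + (1 : ℂ) • g = g
      simp
    · rintro _ ⟨h, rfl⟩
      refine ⟨WithLp.toLp 2 (c⁻¹ • h, 0), WithLp.ofLp_injective 2 (Prod.ext ?_ rfl)⟩
      change c • innerMul hφ (c⁻¹ • h) + (0 : ℂ) • g = innerMul hφ h
      rw [map_smul, smul_inv_smul₀ hc, zero_smul, add_zero]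

theorem inner_innerMul_eq_zero (hφ : IsScalarInner φ) (hg : typeTwoLine g ⟂ typeOneSubspace φ)
    (h : HardyDisc ℂ) : ⟪g, innerMul hφ h⟫_ℂ = 0 := by
  rw [← range_typeOneMap hφ] at hg
  have := Submodule.isOrtho_iff_inner_eq.1 hg _ (Submodule.mem_span_singleton_self _) _ ⟨h, rfl⟩
  simpa [WithLp.prod_inner_apply, typeOneMap_fst, typeOneMap_snd] using this

theorem norm_sq_typeTwoMap_fst (hφ : IsScalarInner φ) (hg : typeTwoLine g ⟂ typeOneSubspace φ)
    (hc : ‖c‖ = 1) (x : LowerSpace) :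
    ‖(typeTwoMap hφ g c x).fst‖ ^ 2 = ‖x.fst‖ ^ 2 + ‖g‖ ^ 2 * ‖x.snd‖ ^ 2 := by
  have h : ⟪g, c • innerMul hφ x.fst⟫_ℂ = 0 := by
    rw [inner_smul_right, inner_innerMul_eq_zero hφ hg, mul_zero]
  rw [typeTwoMap_fst, norm_sq_add_smul_of_inner_eq_zero h, norm_smul, hc, one_mul,
    LinearIsometry.norm_map, mul_comm (‖g‖ ^ 2)]

/-- Clearing the denominator in the definition of `g`; here `c = conj φ(e^{iθ})`. -/
theorem IsTypeTwoData.exists_hardyShift_add_eq (h : IsTypeTwoData σ θ φ g) (hφ : IsScalarInner φ) :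
    ∃ c : ℂ, hardyShift g + (σ : ℂ) • hardyConst 1 =
      Complex.exp (Complex.I * θ) • g + (σ : ℂ) • innerMul hφ (hardyConst c) := by
  obtain ⟨-, c, -, hg⟩ := h
  refine ⟨conj c, HardyDisc.ext fun z => ?_⟩
  have hz : (z : ℂ) - Complex.exp (Complex.I * θ) ≠ 0 := fun h0 => by
    have := z.norm_lt_one
    rw [sub_eq_zero.1 h0, Complex.norm_exp_I_mul_ofReal] at this
    exact lt_irrefl _ this
  change z * g z + σ * 1 = Complex.exp (Complex.I * θ) * g z + σ * (φ z * conj c)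
  rw [hg z]
  field_simp
  ring

theorem norm_eq_one_of_hardyShift_add_eq (hσ : σ ≠ 0) (hφ : IsScalarInner φ)
    (hg : typeTwoLine g ⟂ typeOneSubspace φ)
    (h : hardyShift g + (σ : ℂ) • hardyConst 1 =
      Complex.exp (Complex.I * θ) • g + (σ : ℂ) • innerMul hφ (hardyConst c)) : ‖c‖ = 1 := by
  have hleft : ‖hardyShift g + (σ : ℂ) • hardyConst 1‖ ^ 2 = ‖g‖ ^ 2 + σ ^ 2 := by
    rw [norm_sq_add_smul_of_inner_eq_zero (inner_hardyConst_hardyShift _ _)]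
    simp
  have horth : ⟪innerMul hφ (hardyConst c), Complex.exp (Complex.I * θ) • g⟫_ℂ = 0 := by
    rw [inner_smul_right, inner_eq_zero_symm.1 (inner_innerMul_eq_zero hφ hg _), mul_zero]
  have hright : ‖Complex.exp (Complex.I * θ) • g + (σ : ℂ) • innerMul hφ (hardyConst c)‖ ^ 2 =
      ‖g‖ ^ 2 + σ ^ 2 * ‖c‖ ^ 2 := by
    rw [norm_sq_add_smul_of_inner_eq_zero horth, norm_smul, Complex.norm_exp_I_mul_ofReal]
    simp
  have heq : σ ^ 2 * ‖c‖ ^ 2 = σ ^ 2 * 1 := by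
    rw [h, hright] at hleft
    linear_combination hleft
  exact (pow_eq_one_iff_of_nonneg (norm_nonneg c) two_ne_zero).1
    (mul_left_cancel₀ (pow_ne_zero 2 hσ) heq)

theorem brownianShift_typeTwoMap (hφ : IsScalarInner φ)
    (h : hardyShift g + (σ : ℂ) • hardyConst 1 =
      Complex.exp (Complex.I * θ) • g + (σ : ℂ) • innerMul hφ (hardyConst c)) (x : LowerSpace) :
    brownianShift σ θ (typeTwoMap hφ g c x) = typeTwoMap hφ g c (brownianShift σ θ x) := by
  refine WithLp.ofLp_injective 2 (Prod.ext (HardyDisc.ext fun z => ?_) rfl)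
  have hz : z * g z + σ * 1 = Complex.exp (Complex.I * θ) * g z + σ * (φ z * c) :=
    congrArg (fun f : HardyDisc ℂ => f z) h
  change z * (c * (φ z * x.fst z) + x.snd * g z) + σ * x.snd =
    c * (φ z * (z * x.fst z + σ * x.snd)) + Complex.exp (Complex.I * θ) * x.snd * g z
  linear_combination x.snd * hz

theorem IsLiftedTypeTwo.exists_isLiftedModel {M : Submodule ℂ BrownianSpace} (hσ : σ ≠ 0)
    (h : IsLiftedTypeTwo E σ θ g M) :
    ∃ (q : LowerSpace →L[ℂ] LowerSpace) (W : HardyDisc E →ₗᵢ[ℂ] HardyBidisc),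
      IsLiftedModel q W M ∧ (∀ x, ‖(q x).fst‖ ^ 2 = ‖x.fst‖ ^ 2 + ‖g‖ ^ 2 * ‖x.snd‖ ^ 2) ∧
        (∀ x, (q x).snd = x.snd) ∧ ∀ x, brownianShift σ θ (q x) = q (brownianShift σ θ x) := by
  obtain ⟨φ, Ψ, hdata, hΨ, -, hline, -, hφΨ, hgΨ, hM⟩ := h
  obtain ⟨c, hrel⟩ := hdata.exists_hardyShift_add_eq hdata.1
  have hc : ‖c‖ = 1 := norm_eq_one_of_hardyShift_add_eq hσ hdata.1 hline hrel
  have hc0 : c ≠ 0 := norm_ne_zero_iff.1 (hc ▸ one_ne_zero)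
  have hrange : LinearMap.range (bidiscLift (π₁ ∘L typeTwoMap hdata.1 g c)) =
      bidiscInnerRange φ ⊔ bidiscTensorRange g := by
    rw [← range_bidiscLift_innerMul hdata.1,
      ← range_bidiscLift_smul (innerMul hdata.1).toContinuousLinearMap hc0,
      ← range_bidiscLift_toSpanSingleton, ← range_bidiscLift_add]
    rfl
  refine ⟨typeTwoMap hdata.1 g c, bidiscOperatorMul hΨ, ⟨bidiscOperatorMul_shift hΨ, ?_, ?_⟩,
    norm_sq_typeTwoMap_fst hdata.1 hline hc, typeTwoMap_snd hdata.1,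
    brownianShift_typeTwoMap hdata.1 hrel⟩
  · rw [hrange, range_bidiscOperatorMul]
    exact Submodule.isOrtho_sup_left.2 ⟨hφΨ, hgΨ⟩
  · rw [hrange, range_bidiscOperatorMul, range_typeTwoMap hdata.1 hc0, hM]

end TypeTwo

section UnitaryInvariants

theorem nonempty_linearIsometryEquiv_of_range_eq {E F K : Type*} [NormedAddCommGroup E]
    [InnerProductSpace ℂ E] [NormedAddCommGroup F] [InnerProductSpace ℂ F] [NormedAddCommGroup K]
    [InnerProductSpace ℂ K] {V : E →ₗᵢ[ℂ] K} {W : F →ₗᵢ[ℂ] K}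
    (h : LinearMap.range V.toLinearMap = LinearMap.range W.toLinearMap) :
    Nonempty (E ≃ₗᵢ[ℂ] F) :=
  ⟨V.equivRange.trans ((LinearIsometryEquiv.ofEq _ _ h).trans W.equivRange.symm)⟩

variable {E : Type u} [NormedAddCommGroup E] [InnerProductSpace ℂ E] [CompleteSpace E]
variable {F : Type v} [NormedAddCommGroup F] [InnerProductSpace ℂ F] [CompleteSpace F]
variable {σ σ₁ σ₂ θ θ₁ θ₂ : ℝ} {g g₁ g₂ : HardyDisc ℂ} {M N : Submodule ℂ BrownianSpace}

theorem norm_sq_le_of_isLiftedTypeTwo (hσ : σ ≠ 0) (h : IsLiftedTypeTwo E σ θ g M)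
    {x : BrownianSpace} (hx : x ∈ M) : (1 + ‖g‖ ^ 2) * ‖x.snd.snd‖ ^ 2 ≤ ‖x.snd‖ ^ 2 := by
  obtain ⟨q, W, hq, hfst, hsnd, -⟩ := h.exists_isLiftedModel hσ
  obtain ⟨-, z, hz⟩ := hq.mem_iff.1 hx
  rw [← hz, WithLp.prod_norm_sq_eq_of_L2 (q z), hfst, hsnd]
  linarith [sq_nonneg ‖z.fst‖]

theorem snd_snd_eq_zero_of_isLiftedTypeOne (h : IsLiftedTypeOne E M) {x : BrownianSpace}
    (hx : x ∈ M) : x.snd.snd = 0 := by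
  obtain ⟨q, W, hq, -, hsnd, -⟩ := h.exists_isLiftedModel
  obtain ⟨-, z, hz⟩ := hq.mem_iff.1 hx
  rw [← hz, hsnd]

theorem toLp_mem_of_isLiftedTypeTwo (h : IsLiftedTypeTwo E σ θ g M) :
    WithLp.toLp 2 (0, WithLp.toLp 2 (g, 1)) ∈ M := by
  obtain ⟨φ, Ψ, -, -, -, -, -, -, -, rfl⟩ := h
  exact ⟨zero_mem _, Submodule.mem_sup_left (Submodule.mem_span_singleton_self _)⟩

theorem exists_mem_fst_eq_zero (h : IsLiftedTypeOne E M ∨ ∃ g, IsLiftedTypeTwo E σ θ g M) :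
    ∃ x ∈ M, x.fst = 0 ∧ x.snd ≠ 0 := by
  rcases h with h | ⟨g, h⟩
  · obtain ⟨q, W, hq, hfst, -⟩ := h.exists_isLiftedModel
    refine ⟨_, hq.toLp_mem 0 0 (hardyConst 1), ?_, fun h0 => ?_⟩
    · change bidiscLift _ 0 + W 0 = 0
      rw [map_zero, map_zero, add_zero]
    · have hnorm : ‖(q (hardyConst 1)).fst‖ = 1 := by
        rw [hfst, hardyConst.norm_map, norm_one]
      have hzero : (q (hardyConst 1)).fst = 0 := congrArg WithLp.fst h0
      rw [hzero, norm_zero] at hnorm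
      exact zero_ne_one hnorm
  · exact ⟨_, toLp_mem_of_isLiftedTypeTwo h, rfl, fun h0 => one_ne_zero (congrArg WithLp.snd h0)⟩

theorem exists_wanderingEmbedding (hσ : σ ≠ 0)
    (h : IsLiftedTypeOne E M ∨ ∃ g, IsLiftedTypeTwo E σ θ g M) :
    ∃ V : E →ₗᵢ[ℂ] M, ∀ x : M, x ∈ Set.range V ↔
      x.1.snd = 0 ∧ ∀ y ∈ M, ⟪threeBrownianShift σ θ y, x⟫_ℂ = 0 := by
  rcases h with h | ⟨g, h⟩
  · obtain ⟨q, W, hq, -⟩ := h.exists_isLiftedModel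
    exact hq.exists_wanderingEmbedding hσ
  · obtain ⟨q, W, hq, -⟩ := h.exists_isLiftedModel hσ
    exact hq.exists_wanderingEmbedding hσ

/-- `U` is a unitary equivalence between the restrictions of two 3-Brownian shifts to `M` and `N`.
The invariance of `M` is part of the definition. -/
def IsBrownianIntertwiner (σ₁ θ₁ σ₂ θ₂ : ℝ) (U : M ≃ₗᵢ[ℂ] N) : Prop :=
  ∀ x : M, ∃ hx : threeBrownianShift σ₁ θ₁ x ∈ M,
    (U ⟨threeBrownianShift σ₁ θ₁ x, hx⟩ : BrownianSpace) = threeBrownianShift σ₂ θ₂ (U x)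

theorem RestrictionsUnitarilyEquivalent.exists_isBrownianIntertwiner
    {hM : ∀ x ∈ M, threeBrownianShift σ₁ θ₁ x ∈ M} {hN : ∀ x ∈ N, threeBrownianShift σ₂ θ₂ x ∈ N}
    (h : RestrictionsUnitarilyEquivalent (threeBrownianShift σ₁ θ₁) (threeBrownianShift σ₂ θ₂)
      M N hM hN) : ∃ U : M ≃ₗᵢ[ℂ] N, IsBrownianIntertwiner σ₁ θ₁ σ₂ θ₂ U :=
  h.imp fun _ hU x => ⟨hM x x.2, congrArg Subtype.val (hU x)⟩

namespace IsBrownianIntertwiner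

variable {U : M ≃ₗᵢ[ℂ] N}

theorem symm (hU : IsBrownianIntertwiner σ₁ θ₁ σ₂ θ₂ U) :
    IsBrownianIntertwiner σ₂ θ₂ σ₁ θ₁ U.symm := fun y => by
  obtain ⟨x, rfl⟩ := U.surjective y
  obtain ⟨hx, hUx⟩ := hU x
  refine ⟨hUx ▸ (U _).2, ?_⟩
  have hy : (⟨threeBrownianShift σ₂ θ₂ (U x), hUx ▸ (U _).2⟩ : N) = U ⟨_, hx⟩ :=
    Subtype.ext hUx.symm
  rw [hy, U.symm_apply_apply, U.symm_apply_apply]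

theorem sq_mul_norm_sq_snd_eq (hU : IsBrownianIntertwiner σ₁ θ₁ σ₂ θ₂ U) (x : M) :
    σ₁ ^ 2 * ‖x.1.snd‖ ^ 2 = σ₂ ^ 2 * ‖(U x).1.snd‖ ^ 2 := by
  obtain ⟨hx, hUx⟩ := hU x
  have hT : ‖threeBrownianShift σ₂ θ₂ (U x)‖ = ‖threeBrownianShift σ₁ θ₁ x‖ :=
    (congrArg norm hUx).symm.trans (U.norm_map ⟨threeBrownianShift σ₁ θ₁ x, hx⟩)
  have hnorm : ‖x.1‖ = ‖(U x).1‖ := (U.norm_map x).symm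
  have hsq : ‖x.1‖ ^ 2 + σ₁ ^ 2 * ‖x.1.snd‖ ^ 2 = ‖(U x).1‖ ^ 2 + σ₂ ^ 2 * ‖(U x).1.snd‖ ^ 2 := by
    rw [← norm_sq_threeBrownianShift σ₁ θ₁, ← norm_sq_threeBrownianShift σ₂ θ₂, hT]
  rwa [hnorm, add_right_inj] at hsq

theorem sigma_le (hU : IsBrownianIntertwiner σ₁ θ₁ σ₂ θ₂ U) (hσ₂ : 0 ≤ σ₂)
    (hE : IsLiftedTypeOne E M ∨ ∃ g, IsLiftedTypeTwo E σ₁ θ₁ g M) : σ₁ ≤ σ₂ := by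
  obtain ⟨x, hx, hfst, hsnd⟩ := exists_mem_fst_eq_zero hE
  lift x to M using hx
  have hnorm : ‖(U x).1.snd‖ ^ 2 ≤ ‖x.1.snd‖ ^ 2 :=
    calc ‖(U x).1.snd‖ ^ 2 ≤ ‖(U x).1‖ ^ 2 := by
          rw [WithLp.prod_norm_sq_eq_of_L2 (U x).1]
          exact le_add_of_nonneg_left (sq_nonneg _)
      _ = ‖x.1‖ ^ 2 := congrArg (· ^ 2) (U.norm_map x)
      _ = ‖x.1.snd‖ ^ 2 := by
          rw [WithLp.prod_norm_sq_eq_of_L2 x.1, hfst, norm_zero, sq (0 : ℝ), zero_mul, zero_add]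
  have hsq : σ₁ ^ 2 ≤ σ₂ ^ 2 :=
    le_of_mul_le_mul_right ((hU.sq_mul_norm_sq_snd_eq x).trans_le
      (mul_le_mul_of_nonneg_left hnorm (sq_nonneg σ₂))) (pow_pos (norm_pos_iff.2 hsnd) 2)
  exact le_of_sq_le_sq hsq hσ₂

theorem norm_snd_eq (hU : IsBrownianIntertwiner σ θ₁ σ θ₂ U) (hσ : σ ≠ 0)
    (x : M) : ‖(U x).1.snd‖ = ‖x.1.snd‖ :=
  (pow_left_inj₀ (norm_nonneg _) (norm_nonneg _) two_ne_zero).1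
    (mul_left_cancel₀ (pow_ne_zero 2 hσ) (hU.sq_mul_norm_sq_snd_eq x)).symm

theorem norm_snd_snd_eq (hU : IsBrownianIntertwiner σ θ₁ σ θ₂ U) (hσ : σ ≠ 0)
    (x : M) : ‖(U x).1.snd.snd‖ = ‖x.1.snd.snd‖ := by
  obtain ⟨hx, hUx⟩ := hU x
  have hT : ‖brownianShift σ θ₂ (U x).1.snd‖ = ‖brownianShift σ θ₁ x.1.snd‖ := by
    have := hU.norm_snd_eq hσ ⟨_, hx⟩
    rwa [hUx, threeBrownianShift_snd, threeBrownianShift_snd] at this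
  have hsq : σ ^ 2 * ‖(U x).1.snd.snd‖ ^ 2 = σ ^ 2 * ‖x.1.snd.snd‖ ^ 2 := by
    have := congrArg (· ^ 2) hT
    simp only [norm_sq_brownianShift, hU.norm_snd_eq hσ x] at this
    exact add_left_cancel this
  exact (pow_left_inj₀ (norm_nonneg _) (norm_nonneg _) two_ne_zero).1
    (mul_left_cancel₀ (pow_ne_zero 2 hσ) hsq)

theorem nonempty_linearIsometryEquiv (hU : IsBrownianIntertwiner σ θ₁ σ θ₂ U) (hσ : σ ≠ 0)
    (hE : IsLiftedTypeOne E M ∨ ∃ g, IsLiftedTypeTwo E σ θ₁ g M)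
    (hF : IsLiftedTypeOne F N ∨ ∃ g, IsLiftedTypeTwo F σ θ₂ g N) : Nonempty (E ≃ₗᵢ[ℂ] F) := by
  obtain ⟨V, hV⟩ := exists_wanderingEmbedding hσ hE
  obtain ⟨W, hW⟩ := exists_wanderingEmbedding hσ hF
  have hinner : ∀ x y : M, ⟪threeBrownianShift σ θ₂ (U y), (U x : BrownianSpace)⟫_ℂ =
      ⟪threeBrownianShift σ θ₁ y, (x : BrownianSpace)⟫_ℂ := fun x y => by
    obtain ⟨hy, hUy⟩ := hU y
    have hmap := LinearIsometryEquiv.inner_map_map (𝕜 := ℂ) (E := M) (E' := N) U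
      ⟨threeBrownianShift σ θ₁ y, hy⟩ x
    rwa [Submodule.coe_inner, Submodule.coe_inner, hUy] at hmap
  have hiff : ∀ x : M, x ∈ Set.range V ↔ U x ∈ Set.range W := fun x => by
    rw [hV, hW, ← norm_eq_zero, ← hU.norm_snd_eq hσ, norm_eq_zero]
    refine and_congr_right fun _ => ⟨fun hx y hy => ?_, fun hx y hy => ?_⟩
    · obtain ⟨v, hv⟩ := U.surjective ⟨y, hy⟩
      have := hinner x v
      rwa [hv, hx v v.2] at this
    · exact (hinner x ⟨y, hy⟩).symm.trans (hx _ (U ⟨y, hy⟩).2)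
  refine nonempty_linearIsometryEquiv_of_range_eq (K := N) (V := U.toLinearIsometry.comp V)
    (W := W) (Submodule.ext fun y => ?_)
  obtain ⟨x, rfl⟩ := U.surjective y
  exact (exists_congr fun e => U.injective.eq_iff).trans (hiff x)

theorem not_isLiftedTypeTwo_of_isLiftedTypeOne (hU : IsBrownianIntertwiner σ θ₁ σ θ₂ U)
    (hσ : σ ≠ 0) (hE : IsLiftedTypeOne E M) : ¬ IsLiftedTypeTwo F σ θ₂ g N := fun hF => by
  obtain ⟨x, hx⟩ := U.surjective ⟨_, toLp_mem_of_isLiftedTypeTwo hF⟩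
  have hnorm := hU.norm_snd_snd_eq hσ x
  rw [hx, snd_snd_eq_zero_of_isLiftedTypeOne hE x.2, norm_zero] at hnorm
  exact one_ne_zero (norm_eq_zero.1 hnorm)

theorem exp_eq (hU : IsBrownianIntertwiner σ θ₁ σ θ₂ U) (hσ : σ ≠ 0)
    (hE : IsLiftedTypeTwo E σ θ₁ g M) :
    Complex.exp (Complex.I * θ₁) = Complex.exp (Complex.I * θ₂) := by
  let x : M := ⟨_, toLp_mem_of_isLiftedTypeTwo hE⟩
  obtain ⟨hTx, hUx⟩ := hU x
  let y : M := ⟨_, hTx⟩ - Complex.exp (Complex.I * θ₁) • x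
  have hx : ‖(U x).1.snd.snd‖ = 1 := (hU.norm_snd_snd_eq hσ x).trans norm_one
  have hy : y.1.snd.snd = 0 := sub_self _
  have hUy : (U y).1.snd.snd =
      (Complex.exp (Complex.I * θ₂) - Complex.exp (Complex.I * θ₁)) * (U x).1.snd.snd := by
    rw [map_sub, map_smul, Submodule.coe_sub, hUx, sub_mul]
    rfl
  have hzero := hU.norm_snd_snd_eq hσ y
  rw [hy, hUy, norm_mul, hx, mul_one, norm_zero, norm_eq_zero] at hzero
  exact (sub_eq_zero.1 hzero).symm

theorem norm_le (hU : IsBrownianIntertwiner σ θ₁ σ θ₂ U) (hσ : σ ≠ 0)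
    (hE : IsLiftedTypeTwo E σ θ₁ g₁ M) (hF : IsLiftedTypeTwo F σ θ₂ g₂ N) :
    ‖g₂‖ ≤ ‖g₁‖ := by
  let x : M := ⟨_, toLp_mem_of_isLiftedTypeTwo hE⟩
  have hα : ‖x.1.snd.snd‖ = 1 := norm_one
  have hx : ‖x.1.snd‖ ^ 2 = ‖g₁‖ ^ 2 + 1 := by
    rw [WithLp.prod_norm_sq_eq_of_L2 x.1.snd, hα, one_pow]
    rfl
  have hle := norm_sq_le_of_isLiftedTypeTwo hσ hF (U x).2
  rw [hU.norm_snd_eq hσ, hU.norm_snd_snd_eq hσ, hα, hx] at hle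
  exact le_of_sq_le_sq (by linarith) (norm_nonneg g₁)

end IsBrownianIntertwiner

end UnitaryInvariants

section Construction

theorem exists_linearIsometryEquiv_of_norm_eq {X K L : Type*} [AddCommGroup X] [Module ℂ X]
    [NormedAddCommGroup K] [InnerProductSpace ℂ K] [NormedAddCommGroup L] [InnerProductSpace ℂ L]
    {A : X →ₗ[ℂ] K} {B : X →ₗ[ℂ] L} (hA : Function.Surjective A) (hB : Function.Surjective B)
    (h : ∀ x, ‖A x‖ = ‖B x‖) : ∃ U : K ≃ₗᵢ[ℂ] L, ∀ x, U (A x) = B x := by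
  have hAB : ∀ x y, A x = A y → B x = B y := fun x y hxy => by
    rw [← sub_eq_zero, ← map_sub, ← norm_eq_zero, ← h, map_sub, hxy, sub_self, norm_zero]
  choose f hf using hA
  refine ⟨LinearIsometryEquiv.ofSurjective
    { toFun := fun y => B (f y)
      map_add' := fun y z => by
        rw [← map_add]
        exact hAB _ _ (by rw [hf, map_add, hf, hf])
      map_smul' := fun c y => by
        rw [RingHom.id_apply, ← map_smul]
        exact hAB _ _ (by rw [hf, map_smul, hf])
      norm_map' := fun y => (h (f y)).symm.trans (congrArg norm (hf y)) } fun z => ?_,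
    fun x => hAB _ _ (hf _)⟩
  obtain ⟨x, rfl⟩ := hB z
  exact ⟨A x, hAB _ _ (hf _)⟩

theorem restrictionsUnitarilyEquivalent_of_norm_eq {X H : Type*} [AddCommGroup X] [Module ℂ X]
    [NormedAddCommGroup H] [InnerProductSpace ℂ H] {T₁ T₂ : H →L[ℂ] H} {M N : Submodule ℂ H}
    {A : X →ₗ[ℂ] M} {B : X →ₗ[ℂ] N} {S : X → X} (hA : Function.Surjective A)
    (hB : Function.Surjective B) (hnorm : ∀ x, ‖A x‖ = ‖B x‖) (hT₁ : ∀ x, T₁ (A x) = A (S x))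
    (hT₂ : ∀ x, T₂ (B x) = B (S x)) (hM : ∀ x ∈ M, T₁ x ∈ M) (hN : ∀ x ∈ N, T₂ x ∈ N) :
    RestrictionsUnitarilyEquivalent T₁ T₂ M N hM hN := by
  obtain ⟨U, hU⟩ := exists_linearIsometryEquiv_of_norm_eq hA hB hnorm
  refine ⟨U, fun y => ?_⟩
  obtain ⟨x, rfl⟩ := hA y
  have hx : (⟨T₁ (A x), hM _ (A x).2⟩ : M) = A (S x) := Subtype.ext (hT₁ x)
  refine Subtype.ext ?_
  rw [hx, hU]
  exact (hT₂ x).symm.trans (congrArg (fun z : N => T₂ z) (hU x).symm)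

namespace IsLiftedModel

variable {E : Type u} [NormedAddCommGroup E] [InnerProductSpace ℂ E] [CompleteSpace E]
variable {Z : Type*} [NormedAddCommGroup Z] [InnerProductSpace ℂ Z] [CompleteSpace Z]
variable {q q' : Z →L[ℂ] LowerSpace} {W W' : HardyDisc E →ₗᵢ[ℂ] HardyBidisc}
variable {M N : Submodule ℂ BrownianSpace} {σ θ θ₁ θ₂ : ℝ} {R : Z → Z}

/-- The parametrization of `M` by `H²(𝔻; Z) × H²(𝔻; E) × Z` given by a model. -/
def param (h : IsLiftedModel q W M) : HardyDisc Z × HardyDisc E × Z →ₗ[ℂ] M :=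
  LinearMap.codRestrict M
    ((WithLp.prodContinuousLinearEquiv 2 ℂ HardyBidisc LowerSpace).symm.toLinearMap ∘ₗ
      (LinearMap.coprod (bidiscLift (π₁ ∘L q)) (W.toLinearMap ∘ₗ LinearMap.fst ℂ _ _)).prod
        (q.toLinearMap ∘ₗ LinearMap.snd ℂ _ _ ∘ₗ LinearMap.snd ℂ _ _))
    fun p => h.toLp_mem p.1 p.2.1 p.2.2

theorem param_fst (h : IsLiftedModel q W M) (y : HardyDisc Z) (u : HardyDisc E) (z : Z) :
    (h.param (y, u, z)).1.fst = bidiscLift (π₁ ∘L q) y + W u := rfl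

theorem param_snd (h : IsLiftedModel q W M) (y : HardyDisc Z) (u : HardyDisc E) (z : Z) :
    (h.param (y, u, z)).1.snd = q z := rfl

theorem param_surjective (h : IsLiftedModel q W M) : Function.Surjective h.param := fun x => by
  obtain ⟨⟨y, u, hyu⟩, z, hz⟩ := h.mem_iff.1 x.2
  exact ⟨(y, u, z), Subtype.ext (WithLp.ofLp_injective 2 (Prod.ext hyu hz))⟩

theorem norm_sq_param (h : IsLiftedModel q W M) (y : HardyDisc Z) (u : HardyDisc E) (z : Z) :
    ‖h.param (y, u, z)‖ ^ 2 =
      ‖bidiscLift (π₁ ∘L q) y‖ ^ 2 + ‖u‖ ^ 2 + (‖(q z).fst‖ ^ 2 + ‖(q z).snd‖ ^ 2) := by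
  have hsum := norm_add_sq_eq_norm_sq_add_norm_sq_of_inner_eq_zero _ _
    (h.inner_bidiscLift_eq_zero y u)
  rw [Submodule.coe_norm, WithLp.prod_norm_sq_eq_of_L2 (h.param (y, u, z)).1, h.param_fst,
    h.param_snd, WithLp.prod_norm_sq_eq_of_L2 (q z), sq ‖_ + W u‖, hsum, W.norm_map]
  ring

theorem threeBrownianShift_param (h : IsLiftedModel q W M)
    (hR : ∀ z, brownianShift σ θ (q z) = q (R z)) (y : HardyDisc Z) (u : HardyDisc E) (z : Z) :
    threeBrownianShift σ θ (h.param (y, u, z)) =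
      h.param (HardyDisc.shift Z y + (σ : ℂ) • HardyDisc.const Z z, HardyDisc.shift E u, R z) :=
  WithLp.ofLp_injective 2 (Prod.ext (h.threeBrownianShift_fst_eq rfl rfl) (hR z))

theorem restrictionsUnitarilyEquivalent (h : IsLiftedModel q W M) (h' : IsLiftedModel q' W' N)
    (hfst : ∀ z, ‖(q z).fst‖ = ‖(q' z).fst‖) (hsnd : ∀ z, ‖(q z).snd‖ = ‖(q' z).snd‖)
    (hR : ∀ z, brownianShift σ θ₁ (q z) = q (R z))
    (hR' : ∀ z, brownianShift σ θ₂ (q' z) = q' (R z))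
    (hM : ∀ x ∈ M, threeBrownianShift σ θ₁ x ∈ M) (hN : ∀ x ∈ N, threeBrownianShift σ θ₂ x ∈ N) :
    RestrictionsUnitarilyEquivalent (threeBrownianShift σ θ₁) (threeBrownianShift σ θ₂)
      M N hM hN := by
  have hlift (y) : ‖bidiscLift (π₁ ∘L q) y‖ = ‖bidiscLift (π₁ ∘L q') y‖ :=
    norm_bidiscLift_congr (ℓ := π₁ ∘L q) (ℓ' := π₁ ∘L q') hfst y
  have hnorm : ∀ p, ‖h.param p‖ = ‖h'.param p‖ := fun ⟨y, u, z⟩ => by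
    rw [← pow_left_inj₀ (norm_nonneg _) (norm_nonneg _) two_ne_zero, h.norm_sq_param,
      h'.norm_sq_param, hlift, hfst, hsnd]
  let S : HardyDisc Z × HardyDisc E × Z → HardyDisc Z × HardyDisc E × Z := fun p =>
    (HardyDisc.shift Z p.1 + (σ : ℂ) • HardyDisc.const Z p.2.2, HardyDisc.shift E p.2.1, R p.2.2)
  exact restrictionsUnitarilyEquivalent_of_norm_eq (S := S) h.param_surjective
    h'.param_surjective hnorm
    (fun ⟨y, u, z⟩ => h.threeBrownianShift_param hR y u z)
    (fun ⟨y, u, z⟩ => h'.threeBrownianShift_param hR' y u z) hM hN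

end IsLiftedModel

variable {E : Type u} [NormedAddCommGroup E] [InnerProductSpace ℂ E] [CompleteSpace E]
variable {F : Type v} [NormedAddCommGroup F] [InnerProductSpace ℂ F] [CompleteSpace F]
variable {σ θ θ₁ θ₂ : ℝ} {g₁ g₂ : HardyDisc ℂ} {M N : Submodule ℂ BrownianSpace}

theorem IsLiftedTypeOne.restrictionsUnitarilyEquivalent (hE : IsLiftedTypeOne E M)
    (hF : IsLiftedTypeOne F N) (V : E ≃ₗᵢ[ℂ] F) (hM : ∀ x ∈ M, threeBrownianShift σ θ₁ x ∈ M)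
    (hN : ∀ x ∈ N, threeBrownianShift σ θ₂ x ∈ N) :
    RestrictionsUnitarilyEquivalent (threeBrownianShift σ θ₁) (threeBrownianShift σ θ₂)
      M N hM hN := by
  obtain ⟨q, W, hq, hfst, hsnd, hR⟩ := hE.exists_isLiftedModel
  obtain ⟨q', W', hq', hfst', hsnd', hR'⟩ := hF.exists_isLiftedModel
  exact hq.restrictionsUnitarilyEquivalent (hq'.comp_mapIsometry V)
    (fun f => (hfst f).trans (hfst' f).symm) (fun f => by rw [hsnd, hsnd']) (hR σ θ₁) (hR' σ θ₂)
    hM hN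

theorem IsLiftedTypeTwo.restrictionsUnitarilyEquivalent (hσ : σ ≠ 0)
    (hE : IsLiftedTypeTwo E σ θ g₁ M) (hF : IsLiftedTypeTwo F σ θ g₂ N) (V : E ≃ₗᵢ[ℂ] F)
    (hg : ‖g₁‖ = ‖g₂‖) (hM : ∀ x ∈ M, threeBrownianShift σ θ x ∈ M)
    (hN : ∀ x ∈ N, threeBrownianShift σ θ x ∈ N) :
    RestrictionsUnitarilyEquivalent (threeBrownianShift σ θ) (threeBrownianShift σ θ)
      M N hM hN := by
  obtain ⟨q, W, hq, hfst, hsnd, hR⟩ := hE.exists_isLiftedModel hσ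
  obtain ⟨q', W', hq', hfst', hsnd', hR'⟩ := hF.exists_isLiftedModel hσ
  refine hq.restrictionsUnitarilyEquivalent (hq'.comp_mapIsometry V) (fun x => ?_)
    (fun x => by rw [hsnd, hsnd']) hR hR' hM hN
  rw [← pow_left_inj₀ (norm_nonneg _) (norm_nonneg _) two_ne_zero, hfst, hfst', hg]

end Construction

section Dimension

variable {E : Type u} [NormedAddCommGroup E] [InnerProductSpace ℂ E] [CompleteSpace E]
variable {F : Type v} [NormedAddCommGroup F] [InnerProductSpace ℂ F] [CompleteSpace F]

theorem exists_hilbertBasis_mk_eq_hilbertDim (E : Type u) [NormedAddCommGroup E]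
    [InnerProductSpace ℂ E] [CompleteSpace E] :
    ∃ s : Set E, Nonempty (HilbertBasis s ℂ E) ∧ Cardinal.mk s = hilbertDim E := by
  obtain ⟨w, b, -⟩ := exists_hilbertBasis ℂ E
  exact csInf_mem (s := {κ | ∃ s : Set E, Nonempty (HilbertBasis s ℂ E) ∧ Cardinal.mk s = κ})
    ⟨_, w, ⟨b⟩, rfl⟩

theorem nonempty_hilbertBasis_of_equiv {ι κ : Type*} (b : HilbertBasis ι ℂ E) (e : κ ≃ ι) :
    Nonempty (HilbertBasis κ ℂ E) := by
  refine ⟨HilbertBasis.mk (b.orthonormal.comp e e.injective) ?_⟩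
  rw [e.surjective.range_comp]
  exact b.dense_span.ge

theorem lift_hilbertDim_le_of_linearIsometryEquiv (V : E ≃ₗᵢ[ℂ] F) :
    Cardinal.lift.{u} (hilbertDim F) ≤ Cardinal.lift.{v} (hilbertDim E) := by
  obtain ⟨s, ⟨b⟩, hs⟩ := exists_hilbertBasis_mk_eq_hilbertDim E
  let b' : HilbertBasis s ℂ F := ⟨V.symm.trans b.repr⟩
  have hinj : Function.Injective b' := b'.orthonormal.linearIndependent.injective
  obtain ⟨c⟩ := nonempty_hilbertBasis_of_equiv b' (Equiv.ofInjective _ hinj).symm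
  rw [← hs, ← Cardinal.mk_range_eq_of_injective hinj, Cardinal.lift_le]
  exact csInf_le' ⟨_, ⟨c⟩, rfl⟩

theorem lift_hilbertDim_eq_iff_nonempty_linearIsometryEquiv :
    Cardinal.lift.{v} (hilbertDim E) = Cardinal.lift.{u} (hilbertDim F) ↔
      Nonempty (E ≃ₗᵢ[ℂ] F) := by
  constructor
  · intro h
    obtain ⟨s, ⟨b⟩, hs⟩ := exists_hilbertBasis_mk_eq_hilbertDim E
    obtain ⟨t, ⟨c⟩, ht⟩ := exists_hilbertBasis_mk_eq_hilbertDim F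
    rw [← hs, ← ht, Cardinal.lift_mk_eq'] at h
    obtain ⟨e⟩ := h
    obtain ⟨c'⟩ := nonempty_hilbertBasis_of_equiv c e
    exact ⟨b.repr.trans c'.repr.symm⟩
  · rintro ⟨V⟩
    exact le_antisymm (lift_hilbertDim_le_of_linearIsometryEquiv V.symm)
      (lift_hilbertDim_le_of_linearIsometryEquiv V)

end Dimension

theorem eq_of_exp_I_mul_eq {θ₁ θ₂ : ℝ} (h₁ : θ₁ ∈ Set.Ico 0 (2 * Real.pi))
    (h₂ : θ₂ ∈ Set.Ico 0 (2 * Real.pi))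
    (h : Complex.exp (Complex.I * θ₁) = Complex.exp (Complex.I * θ₂)) : θ₁ = θ₂ := by
  refine Circle.exp_injOn_Ico (a := 0) (b := 2 * Real.pi) (by simp) h₁ h₂ (Circle.ext ?_)
  rwa [Circle.coe_exp, Circle.coe_exp, mul_comm, mul_comm (θ₂ : ℂ)]

end

theorem theorem1p1
    (σ₁ σ₂ θ₁ θ₂ : ℝ) (hσ₁ : 0 < σ₁) (hσ₂ : 0 < σ₂)
    (hθ₁ : θ₁ ∈ Set.Ico 0 (2 * Real.pi)) (hθ₂ : θ₂ ∈ Set.Ico 0 (2 * Real.pi))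
    (E_M : Type u) [NormedAddCommGroup E_M] [InnerProductSpace ℂ E_M] [CompleteSpace E_M]
    (E_N : Type v) [NormedAddCommGroup E_N] [InnerProductSpace ℂ E_N] [CompleteSpace E_N]
    (M N : Submodule ℂ BrownianSpace)
    (hM0 : M ≠ ⊥) (hN0 : N ≠ ⊥)
    (hMc : IsClosed (M : Set BrownianSpace)) (hNc : IsClosed (N : Set BrownianSpace))
    (hMinv : ∀ x ∈ M, threeBrownianShift σ₁ θ₁ x ∈ M)
    (hNinv : ∀ x ∈ N, threeBrownianShift σ₂ θ₂ x ∈ N)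
    (hM : IsLiftedTypeOne E_M M ∨ ∃ g, IsLiftedTypeTwo E_M σ₁ θ₁ g M)
    (hN : IsLiftedTypeOne E_N N ∨ ∃ g, IsLiftedTypeTwo E_N σ₂ θ₂ g N) :
    RestrictionsUnitarilyEquivalent (threeBrownianShift σ₁ θ₁) (threeBrownianShift σ₂ θ₂)
        M N hMinv hNinv ↔
      σ₁ = σ₂ ∧
      Cardinal.lift.{v} (hilbertDim E_M) = Cardinal.lift.{u} (hilbertDim E_N) ∧
      ((IsLiftedTypeOne E_M M ∧ IsLiftedTypeOne E_N N) ∨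
        (θ₁ = θ₂ ∧ ∃ g₁ g₂ : HardyDisc ℂ,
          IsLiftedTypeTwo E_M σ₁ θ₁ g₁ M ∧ IsLiftedTypeTwo E_N σ₂ θ₂ g₂ N ∧ ‖g₁‖ = ‖g₂‖)) := by
  rw [lift_hilbertDim_eq_iff_nonempty_linearIsometryEquiv]
  constructor
  · intro h
    obtain ⟨U, hU⟩ := h.exists_isBrownianIntertwiner
    obtain rfl : σ₁ = σ₂ := (hU.sigma_le hσ₂.le hM).antisymm (hU.symm.sigma_le hσ₁.le hN)
    have hσ := hσ₁.ne'
    refine ⟨rfl, hU.nonempty_linearIsometryEquiv hσ hM hN, ?_⟩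
    rcases hM with hM | ⟨g₁, hM⟩ <;> rcases hN with hN | ⟨g₂, hN⟩
    · exact Or.inl ⟨hM, hN⟩
    · exact absurd hN (hU.not_isLiftedTypeTwo_of_isLiftedTypeOne hσ hM)
    · exact absurd hM (hU.symm.not_isLiftedTypeTwo_of_isLiftedTypeOne hσ hN)
    · exact Or.inr ⟨eq_of_exp_I_mul_eq hθ₁ hθ₂ (hU.exp_eq hσ hM), g₁, g₂, hM, hN,
        (hU.symm.norm_le hσ hN hM).antisymm (hU.norm_le hσ hM hN)⟩
  · rintro ⟨rfl, ⟨V⟩, ⟨hM, hN⟩ | ⟨rfl, g₁, g₂, hM, hN, hg⟩⟩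
    · exact hM.restrictionsUnitarilyEquivalent hN V hMinv hNinv
    · exact hM.restrictionsUnitarilyEquivalent hσ₁.ne' hN V hg hMinv hNinv
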